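/- Let $UVB_n$ be the unrestricted virtual braid group on $n$ strands, i.e. the group with generators $\sigma_1,\dots,\sigma_{n-1},\rho_1,\dots,\rho_{n-1}$ and the following defining relations, where $1\le i\le n-2$ in the relations that involve the index $i+1$: $$\sigma_i\sigma_{i+1}\sigma_i=\sigma_{i+1}\sigma_i\sigma_{i+1},\quad \sigma_i\sigma_j=\sigma_j\sigma_i\ (|i-j|\ge 2),$$ $$\rho_i\rho_{i+1}\rho_i=\rho_{i+1}\rho_i\rho_{i+1},\quad \rho_i\rho_j=\rho_j\rho_i\ (|i-j|\ge 2),\quad \rho_i^2=1,$$ $$\sigma_i\rho_j=\rho_j\sigma_i\ (|i-j|\ge 2),\quad \rho_i\rho_{i+1}\sigma_i=\sigma_{i+1}\rho_i\rho_{i+1},$$ $$\rho_i\sigma_{i+1}\sigma_i=\sigma_{i+1}\sigma_i\rho_{i+1},\quad \rho_{i+1}\sigma_i\sigma_{i+1}=\sigma_i\sigma_{i+1}\rho_i .$$ Let $UVP_n$ be the kernel of the homomorphism $UVB_n\to S_n$ that sends $\sigma_i$ and $\rho_i$ to the transposition $(i\ \,i+1)$, let $UVP_n'$ be its commutator subgroup,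 and identify $S_n$ with the subgroup of $UVB_n$ generated by $\rho_1,\dots,\rho_{n-1}$. An (oriented) fused link is a class of oriented link diagrams in the plane with classical and virtual crossings (generic immersions of finitely many oriented circles, each double point being marked as virtual or as classical with over/under information) up to planar isotopy and the classical, virtual and mixed Reidemeister moves and both forbidden moves. The closure $\widehat\alpha$ of $\alpha\in UVB_n$ is the fused link obtained from any word that represents $\alpha$ by drawing $\sigma_i^{\pm1}$ as classical crossings and $\rho_i^{\pm1}$ as virtual crossings of the strands $i$ and $i+1$ and closing the braid in the standard way. Let $\alpha,\beta\in UVP_n$. Suppose that there are representatives $a\in\alpha\,UVP_n'$ and $b\in\beta\,UVP_n'$ of the classes of $\alpha$ and $\beta$ in the abelianization $UVP_n/UVP_n'$ and an element $\mu\in S_n$ such that $b=\mu^{-1}a\mu$. Then the fused links $\widehat\alpha$ and $\widehat\beta$ are equivalent. -/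

import Mathlib

namespace FusedLinks

/-! ### The unrestricted virtual braid group -/

/-- The generators `σ_i` and `ρ_i` of the braid groups on `n` strands. The strands are numbered
`0, …, n - 1`, and the generators with index `i` involve the strands `i` and `i + 1`. -/
inductive Gen (n : ℕ) : Type
  | sigma (i : Fin (n - 1)) : Gen n
  | rho (i : Fin (n - 1)) : Gen n

/-- The free generator `σ_i`. -/
def fσ {n : ℕ} (i : Fin (n - 1)) : FreeGroup (Gen n) := FreeGroup.of (Gen.sigma i)

/-- The free generator `ρ_i`. -/
def fρ {n : ℕ} (i : Fin (n - 1)) : FreeGroup (Gen n) := FreeGroup.of (Gen.rho i)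

/-- The condition `|i - j| ≥ 2`. -/
def Far {m : ℕ} (i j : Fin m) : Prop := (i : ℕ) + 2 ≤ j ∨ (j : ℕ) + 2 ≤ i

/-- The defining relations `x = y` of `UVB_n`; in the relations on three strands, `j = i + 1`. -/
inductive Rel (n : ℕ) : FreeGroup (Gen n) → FreeGroup (Gen n) → Prop
  | B1 (i j : Fin (n - 1)) (h : (j : ℕ) = i + 1) : Rel n (fσ i * fσ j * fσ i) (fσ j * fσ i * fσ j)
  | B2 (i j : Fin (n - 1)) (h : Far i j) : Rel n (fσ i * fσ j) (fσ j * fσ i)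
  | P1 (i j : Fin (n - 1)) (h : (j : ℕ) = i + 1) : Rel n (fρ i * fρ j * fρ i) (fρ j * fρ i * fρ j)
  | P2 (i j : Fin (n - 1)) (h : Far i j) : Rel n (fρ i * fρ j) (fρ j * fρ i)
  | P3 (i : Fin (n - 1)) : Rel n (fρ i * fρ i) 1
  | M1 (i j : Fin (n - 1)) (h : Far i j) : Rel n (fσ i * fρ j) (fρ j * fσ i)
  | M2 (i j : Fin (n - 1)) (h : (j : ℕ) = i + 1) : Rel n (fρ i * fρ j * fσ i) (fσ j * fρ i * fρ j)
  | F1 (i j : Fin (n - 1)) (h : (j : ℕ) = i + 1) : Rel n (fρ i * fσ j * fσ i) (fσ j * fσ i * fρ j)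
  | F2 (i j : Fin (n - 1)) (h : (j : ℕ) = i + 1) : Rel n (fρ j * fσ i * fσ j) (fσ i * fσ j * fρ i)

/-- The relators of `UVB_n`. -/
def relators (n : ℕ) : Set (FreeGroup (Gen n)) := {r | ∃ x y, Rel n x y ∧ r = x * y⁻¹}

/-- The unrestricted virtual braid group `UVB_n`. -/
abbrev UVB (n : ℕ) : Type := PresentedGroup (relators n)

/-- The transposition `τ_i = (i, i + 1)`. -/
def tau {n : ℕ} (i : Fin (n - 1)) : Equiv.Perm (Fin n) :=
  Equiv.swap ⟨i, by omega⟩ ⟨(i : ℕ) + 1, by omega⟩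

/-- Both `σ_i` and `ρ_i` induce the transposition `τ_i`. -/
def genPerm {n : ℕ} : Gen n → Equiv.Perm (Fin n)
  | .sigma i => tau i
  | .rho i => tau i

theorem swap_braid {X : Type*} [DecidableEq X] (x y z : X) (h1 : x ≠ y) (h2 : x ≠ z) (h3 : y ≠ z) :
    Equiv.swap x y * Equiv.swap y z * Equiv.swap x y =
      Equiv.swap y z * Equiv.swap x y * Equiv.swap y z := by
  rw [Equiv.swap_mul_swap_mul_swap h1 h2, Equiv.swap_comm x y, Equiv.swap_comm y z,
    Equiv.swap_mul_swap_mul_swap h3.symm h2.symm, Equiv.swap_comm]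

theorem tau_braid {n : ℕ} (i j : Fin (n - 1)) (h : (j : ℕ) = i + 1) :
    tau i * tau j * tau i = tau j * tau i * tau j := by
  obtain ⟨i, hi⟩ := i
  obtain ⟨j, hj⟩ := j
  simp only at h
  subst h
  refine swap_braid _ _ _ ?_ ?_ ?_ <;> simp only [ne_eq, Fin.mk.injEq] <;> omega

theorem tau_comm {n : ℕ} (i j : Fin (n - 1)) (h : Far i j) : tau i * tau j = tau j * tau i := by
  unfold Far at h
  refine Equiv.Perm.Disjoint.commute fun x => ?_
  simp only [tau, Equiv.swap_apply_def, Fin.ext_iff]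
  by_cases h1 : (x : ℕ) = i <;> by_cases h2 : (x : ℕ) = i + 1
  · omega
  · right; rw [if_neg (by omega), if_neg (by omega)]
  · right; rw [if_neg (by omega), if_neg (by omega)]
  · left; rw [if_neg h1, if_neg h2]

theorem genPerm_relators {n : ℕ} : ∀ r ∈ relators n, FreeGroup.lift genPerm r = 1 := by
  rintro r ⟨x, y, h, rfl⟩
  rw [map_mul, map_inv, mul_inv_eq_one]
  cases h <;> simp only [fσ, fρ, map_mul, map_one, FreeGroup.lift_apply_of, genPerm]
  case P3 i => exact Equiv.swap_mul_self _ _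
  case F2 i j h => exact (tau_braid i j h).symm
  all_goals first | exact tau_comm _ _ ‹_› | exact tau_braid _ _ ‹_›

/-- The homomorphism `ι : UVB_n → S_n` with `σ_i, ρ_i ↦ τ_i`. -/
def iota (n : ℕ) : UVB n →* Equiv.Perm (Fin n) :=
  PresentedGroup.toGroup (f := genPerm) genPerm_relators

/-- The pure unrestricted virtual braid group `UVP_n`. -/
def UVP (n : ℕ) : Subgroup (UVB n) := (iota n).ker

/-- The copy of the symmetric group `S_n` in `UVB_n`, generated by `ρ_1, …, ρ_{n-1}`. -/
def symmSubgroup (n : ℕ) : Subgroup (UVB n) :=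
  Subgroup.closure (Set.range fun i : Fin (n - 1) => (PresentedGroup.of (Gen.rho i) : UVB n))

/-! ### Fused link diagrams

An oriented link diagram in the plane in general position with respect to a height function is cut
by horizontal lines into slices, each of which consists of vertical strands and of one elementary
piece: a cup, a cap or a crossing. It is recorded by the list of its slices, read
along the height function. Between two slices the diagram meets a horizontal line in finitely many
points; they are recorded, from left to right, by the list of the directions of the strands
(`true`: in the reading direction, `false`: against it). -/

/-- The kinds of crossings of two strands, one of which goes from left to right and the other
from right to left in the reading direction: classical with the first of these strands above,
classical with the second one above, and virtual. -/
inductive Kind : Type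
  | lr
  | rl
  | virt

/-- The kind of the crossing in which the two strands exchange their roles: the strand
that went from left to right now goes from right to left, and what is above remains above. -/
def Kind.swap : Kind → Kind
  | .lr => .rl
  | .rl => .lr
  | .virt => .virt

/-- The elementary pieces: `cup d` is an arc that begins two strands, the left one of direction
`d`; `cap` is an arc that ends two strands; `cross k` is a crossing of two strands. -/
inductive Piece : Type
  | cup (d : Bool)
  | cap
  | cross (k : Kind)

/-- The number of strands that enter a piece. -/
def Piece.ins : Piece → ℕ
  | .cup _ => 0
  | .cap => 2
  | .cross _ => 2

/-- The number of strands that leave a piece. -/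
def Piece.outs : Piece → ℕ
  | .cup _ => 2
  | .cap => 0
  | .cross _ => 2

/-- A slice: an elementary piece with `pos` vertical strands to the left of it. -/
structure Slice : Type where
  piece : Piece
  pos : ℕ

/-- The directions of the strands before and after a piece. -/
inductive Piece.Acts : Piece → List Bool → List Bool → Prop
  | cup (d : Bool) : Acts (.cup d) [] [d, !d]
  | cap (d : Bool) : Acts .cap [d, !d] []
  | cross (k : Kind) (x y : Bool) : Acts (.cross k) [x, y] [y, x]

/-- `Runs w S T`: the slices in `w` fit together to an oriented tangle diagram that begins with
strands of the directions `S` and ends with strands of the directions `T`. -/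
inductive Runs : List Slice → List Bool → List Bool → Prop
  | nil (S : List Bool) : Runs [] S S
  | cons {p : Piece} {X Y : List Bool} (h : p.Acts X Y) (L R : List Bool) {w : List Slice}
      {T : List Bool} (hw : Runs w (L ++ Y ++ R) T) :
      Runs (⟨p, L.length⟩ :: w) (L ++ X ++ R) T

/-- An oriented fused link diagram. -/
structure Diagram : Type where
  word : List Slice
  closed : Runs word [] []

/-- The triangle moves of three strands `x, y, z`, in this order from left to right, where `a`,
`b`, `c` are the kinds of the crossings of `x` with `y`, of `x` with `z` and of `y` with `z`:
one of the strands (`x`, `z`, `y` respectively) lies above both others, lies below both others, or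
crosses both others virtually, and is moved across the crossing of these. If the
strand is above or below, this is the classical third Reidemeister move or, if the other two
strands cross virtually, one of the two forbidden moves. If it is virtual, this is the third
virtual move or, if the other two strands cross classically, the mixed move. -/
def Kind.Triangle (a b c : Kind) : Prop := a = b ∨ b = c ∨ c = a.swap

/-- The local moves. The first five generate the isotopies of the plane; the others are
the classical, virtual, mixed and forbidden Reidemeister moves (with `k` classical or virtual). -/
inductive Move : List Slice → List Slice → Prop
  | exchange (s t : Piece) (i d : ℕ) :
      Move [⟨s, i⟩, ⟨t, i + s.outs + d⟩] [⟨t, i + s.ins + d⟩, ⟨s, i⟩]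
  | zigzag_left (d : Bool) (i : ℕ) : Move [⟨.cup d, i + 1⟩, ⟨.cap, i⟩] []
  | zigzag_right (d : Bool) (i : ℕ) : Move [⟨.cup d, i⟩, ⟨.cap, i + 1⟩] []
  | slide_cup (d : Bool) (k : Kind) (i : ℕ) :
      Move [⟨.cup d, i⟩, ⟨.cross k, i + 1⟩] [⟨.cup d, i + 1⟩, ⟨.cross k.swap, i⟩]
  | slide_cap (k : Kind) (i : ℕ) :
      Move [⟨.cross k, i⟩, ⟨.cap, i + 1⟩] [⟨.cross k.swap, i + 1⟩, ⟨.cap, i⟩]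
  | R1_cup (d : Bool) (k : Kind) (i : ℕ) : Move [⟨.cup d, i⟩, ⟨.cross k, i⟩] [⟨.cup (!d), i⟩]
  | R1_cap (k : Kind) (i : ℕ) : Move [⟨.cross k, i⟩, ⟨.cap, i⟩] [⟨.cap, i⟩]
  | R2 (k : Kind) (i : ℕ) : Move [⟨.cross k, i⟩, ⟨.cross k.swap, i⟩] []
  | R3 (a b c : Kind) (h : a.Triangle b c) (i : ℕ) :
      Move [⟨.cross a, i⟩, ⟨.cross b, i + 1⟩, ⟨.cross c, i⟩]
        [⟨.cross c, i + 1⟩, ⟨.cross b, i⟩, ⟨.cross a, i + 1⟩]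

/-- Two diagrams are related by one local move. -/
def Diagram.Step (D E : Diagram) : Prop :=
  ∃ P Q U V : List Slice, Move U V ∧ D.word = P ++ U ++ Q ∧ E.word = P ++ V ++ Q

/-- Two diagrams represent equivalent fused links. -/
def Diagram.Equivalent (D E : Diagram) : Prop := Relation.EqvGen Diagram.Step D E

/-! ### Closures of braids -/

/-- A word in the letters `σ_i^{±1}`, `ρ_i^{±1}`, with `true` for the exponent `1`. -/
abbrev BraidWord (n : ℕ) : Type := List (Gen n × Bool)

/-- The element of `UVB_n` that is represented by a word. -/
def BraidWord.toUVB {n : ℕ} (w : BraidWord n) : UVB n :=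
  PresentedGroup.mk (relators n) (FreeGroup.mk w)

/-- The crossing that represents a letter. -/
def letterSlice {n : ℕ} : Gen n × Bool → Slice
  | (.sigma i, true) => ⟨.cross .lr, i⟩
  | (.sigma i, false) => ⟨.cross .rl, i⟩
  | (.rho i, _) => ⟨.cross .virt, i⟩

/-- The `n` nested cups that begin `n` strands and, to the right of these, `n` returning strands. -/
def cups (n : ℕ) : List Slice := (List.range n).map fun i => ⟨.cup true, i⟩

/-- The `n` nested caps that join `n` strands with `n` returning strands to the right of these. -/
def caps (n : ℕ) : List Slice := (List.range n).reverse.map fun i => ⟨.cap, i⟩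

theorem Runs.append {u v : List Slice} {S T W : List Bool} (hu : Runs u S T) (hv : Runs v T W) :
    Runs (u ++ v) S W := by
  induction hu with
  | nil S => exact hv
  | cons h L R hw ih => exact Runs.cons h L R (ih hv)

theorem runs_single {p : Piece} {X Y S T : List Bool} (h : p.Acts X Y) (L R : List Bool) {i : ℕ}
    (hi : L.length = i) (hS : L ++ X ++ R = S) (hT : L ++ Y ++ R = T) : Runs [⟨p, i⟩] S T := by
  subst hi hS hT
  exact Runs.cons h L R (Runs.nil _)

theorem runs_cups (n : ℕ) :
    Runs (cups n) [] (List.replicate n true ++ List.replicate n false) := by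
  induction n with
  | zero => exact Runs.nil []
  | succ n ih =>
    have h : cups (n + 1) = cups n ++ [⟨.cup true, n⟩] := by simp [cups, List.range_succ]
    rw [h]
    refine ih.append (runs_single (Piece.Acts.cup true) (List.replicate n true)
      (List.replicate n false) (by simp) (by simp) ?_)
    rw [List.replicate_succ' (a := true), List.replicate_succ (a := false)]
    simp

theorem runs_caps (n : ℕ) :
    Runs (caps n) (List.replicate n true ++ List.replicate n false) [] := by
  induction n with
  | zero => exact Runs.nil []
  | succ n ih =>
    have h : caps (n + 1) = [⟨.cap, n⟩] ++ caps n := by simp [caps, List.range_succ]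
    rw [h]
    refine (runs_single (Piece.Acts.cap true) (List.replicate n true)
      (List.replicate n false) (by simp) ?_ (by simp)).append ih
    rw [List.replicate_succ' (a := true), List.replicate_succ (a := false)]
    simp

theorem runs_letters {n : ℕ} (w : BraidWord n) (R : List Bool) :
    Runs (w.map letterSlice) (List.replicate n true ++ R) (List.replicate n true ++ R) := by
  induction w with
  | nil => exact Runs.nil _
  | cons x w ih =>
    have key : ∀ (k : Kind) (i : Fin (n - 1)),
        Runs [⟨.cross k, i⟩] (List.replicate n true ++ R) (List.replicate n true ++ R) := by
      intro k i
      have e : List.replicate (i : ℕ) true ++ [true, true] ++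
          (List.replicate (n - 2 - i) true ++ R) = List.replicate n true ++ R := by
        have h2 : [true, true] = List.replicate 2 true := rfl
        rw [h2, ← List.append_assoc, List.replicate_append_replicate,
          List.replicate_append_replicate]
        congr 2
        omega
      exact runs_single (Piece.Acts.cross k true true) _ _ (by simp) e e
    have hx : Runs [letterSlice x] (List.replicate n true ++ R) (List.replicate n true ++ R) := by
      rcases x with ⟨i | i, _ | _⟩ <;> exact key _ i
    exact hx.append ih

/-- The closure of a braid word: the braid, with all strands in the reading direction, whose ends
are joined to its beginnings by nested arcs to the right of it without further crossings. -/
def BraidWord.closure {n : ℕ} (w : BraidWord n) : Diagram where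
  word := cups n ++ w.map letterSlice ++ caps n
  closed := ((runs_cups n).append (runs_letters w _)).append (runs_caps n)

/-- `D` is a diagram of the closure of the braid `α`. -/
def IsClosure {n : ℕ} (α : UVB n) (D : Diagram) : Prop :=
  ∃ w : BraidWord n, w.toUVB = α ∧ D = w.closure

end FusedLinks

/-!
Cut strand `i` of a braid at some point and join the two ends to a new strand on the right with a
virtual crossing: this does not change the closure, because conjugation moves the crossing to the
last two strands, where the first Reidemeister move removes the new strand.

Conjugating `σ_k ρ_k` by permutations gives pure braids `λ_{ij}`, which generate a subgroup that
contains `UVP_n`. By the braid and the forbidden relations, any two of them commute, except `λ_{ij}`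
and `λ_{ji}`. In a closure, however, `λ_{ij} λ_{ji}` may be replaced by `λ_{ji} λ_{ij}`: cutting the
strands `i` and `j` between the two factors turns `λ_{ij} λ_{ji}` into `λ_{ju} λ_{iv}` with new
strands `u` and `v`, and these commute. Hence commutators of pure braids may be inserted anywhere
without changing the closure.
-/

namespace FusedLinks

/-- Fused links: diagrams up to equivalence. -/
def FusedLink : Type := Quot Diagram.Step

/-- The fused link that is represented by a diagram. -/
def Diagram.link (D : Diagram) : FusedLink := Quot.mk _ D

theorem Diagram.link_eq_link_iff {D E : Diagram} : D.link = E.link ↔ D.Equivalent E :=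
  ⟨Quot.eqvGen_exact, Quot.eqvGen_sound⟩

theorem Diagram.Step.link_eq {D E : Diagram} (h : D.Step E) : D.link = E.link := Quot.sound h

/-! ### Rewriting diagrams -/

theorem Runs.of_append {u v : List Slice} {S W : List Bool} (h : Runs (u ++ v) S W) :
    ∃ T, Runs u S T ∧ Runs v T W := by
  induction u generalizing S with
  | nil => exact ⟨S, Runs.nil S, h⟩
  | cons x u ih =>
    obtain _ | ⟨hp, L, R, hw⟩ := h
    obtain ⟨T, hu, hv⟩ := ih hw
    exact ⟨T, Runs.cons hp L R hu, hv⟩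

/-- `u ⇝ v`: in every diagram the slices `u` may be replaced by the slices `v`, without changing
the fused link. -/
def Rewrites (u v : List Slice) : Prop :=
  ∀ (P Q : List Slice) (D : Diagram), D.word = P ++ u ++ Q →
    ∃ E : Diagram, E.word = P ++ v ++ Q ∧ D.link = E.link

infix:50 " ⇝ " => Rewrites

namespace Rewrites

variable {u v w : List Slice}

theorem refl (u : List Slice) : u ⇝ u := fun _ _ D h => ⟨D, h, rfl⟩

theorem trans (huv : u ⇝ v) (hvw : v ⇝ w) : u ⇝ w := fun P Q D hD =>
  have ⟨E, hE, hDE⟩ := huv P Q D hD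
  have ⟨F, hF, hEF⟩ := hvw P Q E hE
  ⟨F, hF, hDE.trans hEF⟩

instance : Trans Rewrites Rewrites Rewrites := ⟨trans⟩

theorem append_left (w : List Slice) (h : u ⇝ v) : w ++ u ⇝ w ++ v := fun P Q D hD => by
  simpa using h (P ++ w) Q D (by simpa using hD)

theorem append_right (h : u ⇝ v) (w : List Slice) : u ++ w ⇝ v ++ w := fun P Q D hD => by
  simpa using h P (w ++ Q) D (by simpa using hD)

theorem link_eq {D E : Diagram} (h : D.word ⇝ E.word) : D.link = E.link := by
  obtain ⟨F, hF, hDF⟩ := h [] [] D (by simp)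
  obtain rfl : F = E := by
    cases E
    cases F
    simpa using hF
  exact hDF

theorem of_link_eq (hr : ∀ S T, Runs u S T → Runs v S T)
    (hl : ∀ (P Q : List Slice) (D E : Diagram), D.word = P ++ u ++ Q → E.word = P ++ v ++ Q →
      D.link = E.link) : u ⇝ v := by
  rintro P Q ⟨_, hD⟩ rfl
  obtain ⟨T, hPu, hQ⟩ := hD.of_append
  obtain ⟨S, hP, hu⟩ := hPu.of_append
  exact ⟨⟨_, (hP.append (hr S T hu)).append hQ⟩, rfl, hl P Q _ _ rfl rfl⟩

theorem of_move (h : Move u v) (hr : ∀ S T, Runs u S T → Runs v S T) : u ⇝ v :=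
  of_link_eq hr fun P Q _ _ hD hE => Diagram.Step.link_eq ⟨P, Q, u, v, h, hD, hE⟩

theorem of_move_symm (h : Move v u) (hr : ∀ S T, Runs u S T → Runs v S T) : u ⇝ v :=
  of_link_eq hr fun P Q _ _ hD hE => (Diagram.Step.link_eq ⟨P, Q, v, u, h, hE, hD⟩).symm

end Rewrites

/-! ### The moves as rewriting rules -/

theorem runs_nil_iff {S T : List Bool} : Runs [] S T ↔ S = T :=
  ⟨fun h => by cases h; rfl, fun h => h ▸ Runs.nil S⟩

theorem runs_cons_iff {p : Piece} {i : ℕ} {w : List Slice} {S T : List Bool} :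
    Runs (⟨p, i⟩ :: w) S T ↔
      ∃ L X Y R, p.Acts X Y ∧ L.length = i ∧ S = L ++ X ++ R ∧ Runs w (L ++ Y ++ R) T := by
  constructor
  · rintro (_ | ⟨hp, L, R, hw⟩)
    exact ⟨L, _, _, R, hp, rfl, rfl, hw⟩
  · rintro ⟨L, X, Y, R, hp, rfl, rfl, hw⟩
    exact Runs.cons hp L R hw

theorem Piece.Acts.length_ins {p : Piece} {X Y : List Bool} (h : p.Acts X Y) :
    X.length = p.ins := by
  cases h <;> rfl

theorem Piece.Acts.length_outs {p : Piece} {X Y : List Bool} (h : p.Acts X Y) :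
    Y.length = p.outs := by
  cases h <;> rfl

theorem Runs.exists_append {p : Piece} {i j : ℕ} {w : List Slice} {S T : List Bool}
    (h : Runs (⟨p, j⟩ :: w) S T) (hij : i ≤ j) : ∃ L S', L.length = i ∧ S = L ++ S' := by
  obtain ⟨L, X, -, R, -, rfl, rfl, -⟩ := runs_cons_iff.1 h
  exact ⟨_, _, List.length_take_of_le (by simp; omega), (List.take_append_drop i _).symm⟩

theorem exists_eq_append_of_append_eq_append {L L' R R' : List Bool} (h : L ++ R = L' ++ R')
    (hl : L.length ≤ L'.length) : ∃ M, L' = L ++ M ∧ R = M ++ R' := by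
  obtain ⟨M, rfl⟩ := List.prefix_of_prefix_length_le (List.prefix_append L R)
    (h ▸ List.prefix_append L' R') hl
  exact ⟨M, rfl, by simpa using h⟩

theorem runs_add_cons_append_iff {p : Piece} {j : ℕ} {w : List Slice} {L S T : List Bool} :
    Runs (⟨p, L.length + j⟩ :: w) (L ++ S) T ↔
      ∃ A X Y R, p.Acts X Y ∧ A.length = j ∧ S = A ++ X ++ R ∧ Runs w (L ++ (A ++ Y ++ R)) T := by
  rw [runs_cons_iff]
  constructor
  · rintro ⟨L', X, Y, R, hp, hL, hS, hw⟩
    rw [List.append_assoc] at hS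
    obtain ⟨A, rfl, rfl⟩ := exists_eq_append_of_append_eq_append hS (by omega)
    exact ⟨A, X, Y, R, hp, by simpa using hL, by simp, by simpa using hw⟩
  · rintro ⟨A, X, Y, R, hp, rfl, rfl, hw⟩
    exact ⟨L ++ A, X, Y, R, hp, by simp, by simp, by simpa using hw⟩

theorem runs_cons_append_iff {p : Piece} {w : List Slice} {L S T : List Bool} :
    Runs (⟨p, L.length⟩ :: w) (L ++ S) T ↔
      ∃ X Y R, p.Acts X Y ∧ S = X ++ R ∧ Runs w (L ++ (Y ++ R)) T := by
  simpa using runs_add_cons_append_iff (j := 0)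

theorem runs_succ_cons_append_iff {p : Piece} {w : List Slice} {L S T : List Bool} :
    Runs (⟨p, L.length + 1⟩ :: w) (L ++ S) T ↔
      ∃ a X Y R, p.Acts X Y ∧ S = a :: (X ++ R) ∧ Runs w (L ++ a :: (Y ++ R)) T := by
  rw [runs_add_cons_append_iff]
  simp only [List.length_eq_one_iff]
  constructor
  · rintro ⟨_, X, Y, R, hp, ⟨a, rfl⟩, h⟩
    exact ⟨a, X, Y, R, hp, h⟩
  · rintro ⟨a, X, Y, R, hp, h⟩
    exact ⟨_, X, Y, R, hp, ⟨a, rfl⟩, h⟩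

theorem acts_cup_iff {d : Bool} {X Y : List Bool} :
    (Piece.cup d).Acts X Y ↔ X = [] ∧ Y = [d, !d] :=
  ⟨by rintro ⟨⟩; exact ⟨rfl, rfl⟩, by rintro ⟨rfl, rfl⟩; exact .cup d⟩

theorem acts_cap_iff {X Y : List Bool} : Piece.cap.Acts X Y ↔ (∃ d, X = [d, !d]) ∧ Y = [] :=
  ⟨by rintro ⟨⟩; exact ⟨⟨_, rfl⟩, rfl⟩, by rintro ⟨⟨d, rfl⟩, rfl⟩; exact .cap d⟩

theorem acts_cross_iff {k : Kind} {X Y : List Bool} :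
    (Piece.cross k).Acts X Y ↔ ∃ x y, X = [x, y] ∧ Y = [y, x] :=
  ⟨by rintro ⟨⟩; exact ⟨_, _, rfl, rfl⟩, by rintro ⟨x, y, rfl, rfl⟩; exact .cross k x y⟩

theorem runs_cross_append_iff {k : Kind} {w : List Slice} {L S T : List Bool} :
    Runs (⟨.cross k, L.length⟩ :: w) (L ++ S) T ↔
      ∃ x y R, S = x :: y :: R ∧ Runs w (L ++ y :: x :: R) T := by
  simp [runs_cons_append_iff, acts_cross_iff, -Bool.exists_bool]

theorem runs_cross_succ_append_iff {k : Kind} {w : List Slice} {L S T : List Bool} :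
    Runs (⟨.cross k, L.length + 1⟩ :: w) (L ++ S) T ↔
      ∃ a x y R, S = a :: x :: y :: R ∧ Runs w (L ++ a :: y :: x :: R) T := by
  simp [runs_succ_cons_append_iff, acts_cross_iff, -Bool.exists_bool]

theorem runs_cup_append_iff {d : Bool} {w : List Slice} {L S T : List Bool} :
    Runs (⟨.cup d, L.length⟩ :: w) (L ++ S) T ↔ Runs w (L ++ d :: (!d) :: S) T := by
  simp [runs_cons_append_iff, acts_cup_iff]

theorem runs_cup_succ_append_iff {d : Bool} {w : List Slice} {L S T : List Bool} :
    Runs (⟨.cup d, L.length + 1⟩ :: w) (L ++ S) T ↔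
      ∃ a R, S = a :: R ∧ Runs w (L ++ a :: d :: (!d) :: R) T := by
  simp [runs_succ_cons_append_iff, acts_cup_iff, -Bool.exists_bool]

theorem runs_cap_append_iff {w : List Slice} {L S T : List Bool} :
    Runs (⟨.cap, L.length⟩ :: w) (L ++ S) T ↔ ∃ d R, S = d :: (!d) :: R ∧ Runs w (L ++ R) T := by
  simp [runs_cons_append_iff, acts_cap_iff, -Bool.exists_bool]

theorem runs_cap_succ_append_iff {w : List Slice} {L S T : List Bool} :
    Runs (⟨.cap, L.length + 1⟩ :: w) (L ++ S) T ↔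
      ∃ a d R, S = a :: d :: (!d) :: R ∧ Runs w (L ++ a :: R) T := by
  simp [runs_succ_cons_append_iff, acts_cap_iff, -Bool.exists_bool]

namespace Rewrites

theorem R2 (k : Kind) (i : ℕ) : [⟨.cross k, i⟩, ⟨.cross k.swap, i⟩] ⇝ [] := by
  refine of_move (.R2 k i) fun S T h => ?_
  obtain ⟨L, S, rfl, rfl⟩ := h.exists_append le_rfl
  simp only [runs_cross_append_iff, runs_nil_iff] at h ⊢
  grind

theorem R3 {a b c : Kind} (h : a.Triangle b c) (i : ℕ) :
    [⟨.cross a, i⟩, ⟨.cross b, i + 1⟩, ⟨.cross c, i⟩] ⇝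
      [⟨.cross c, i + 1⟩, ⟨.cross b, i⟩, ⟨.cross a, i + 1⟩] := by
  refine of_move (.R3 a b c h i) fun S T h => ?_
  obtain ⟨L, S, rfl, rfl⟩ := h.exists_append le_rfl
  simp only [runs_cross_append_iff, runs_cross_succ_append_iff, runs_nil_iff] at h ⊢
  grind

theorem R1_cap (k : Kind) (i : ℕ) : [⟨.cross k, i⟩, ⟨.cap, i⟩] ⇝ [⟨.cap, i⟩] := by
  refine of_move (.R1_cap k i) fun S T h => ?_
  obtain ⟨L, S, rfl, rfl⟩ := h.exists_append le_rfl
  simp only [runs_cross_append_iff, runs_cap_append_iff, runs_nil_iff] at h ⊢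
  obtain ⟨x, y, R, rfl, d, R', he, rfl⟩ := h
  obtain ⟨rfl, rfl, rfl⟩ : y = d ∧ x = !d ∧ R = R' := by simpa using he
  exact ⟨!y, R, by simp, rfl⟩

theorem zigzag_right (d : Bool) (i : ℕ) : [⟨.cup d, i⟩, ⟨.cap, i + 1⟩] ⇝ [] := by
  refine of_move (.zigzag_right d i) fun S T h => ?_
  obtain ⟨L, S, rfl, rfl⟩ := h.exists_append le_rfl
  simp only [runs_cup_append_iff, runs_cap_succ_append_iff, runs_nil_iff] at h ⊢
  cases d <;> grind

theorem slide_cup_symm (d : Bool) (k : Kind) (i : ℕ) :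
    [⟨.cup d, i + 1⟩, ⟨.cross k.swap, i⟩] ⇝ [⟨.cup d, i⟩, ⟨.cross k, i + 1⟩] := by
  refine of_move_symm (.slide_cup d k i) fun S T h => ?_
  obtain ⟨L, S, rfl, rfl⟩ := h.exists_append (Nat.le_succ _)
  simp only [runs_cross_append_iff, runs_cross_succ_append_iff, runs_cup_append_iff,
    runs_cup_succ_append_iff, runs_nil_iff] at h ⊢
  grind

theorem slide_cap_symm (k : Kind) (i : ℕ) :
    [⟨.cross k.swap, i + 1⟩, ⟨.cap, i⟩] ⇝ [⟨.cross k, i⟩, ⟨.cap, i + 1⟩] := by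
  refine of_move_symm (.slide_cap k i) fun S T h => ?_
  obtain ⟨L, S, rfl, rfl⟩ := h.exists_append (Nat.le_succ _)
  simp only [runs_cross_append_iff, runs_cross_succ_append_iff, runs_cap_append_iff,
    runs_cap_succ_append_iff, runs_nil_iff] at h ⊢
  grind

theorem exchange_symm (s t : Piece) {i j : ℕ} (h : i + s.ins ≤ j) (j' : ℕ)
    (hj : j + s.outs = j' + s.ins) : [⟨t, j⟩, ⟨s, i⟩] ⇝ [⟨s, i⟩, ⟨t, j'⟩] := by
  obtain ⟨d, rfl⟩ := Nat.exists_eq_add_of_le h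
  obtain rfl : j' = i + s.outs + d := by omega
  refine of_move_symm (.exchange s t i d) fun S T h => ?_
  obtain ⟨L, S, rfl, rfl⟩ := h.exists_append (i := i) (by omega)
  simp only [add_assoc, runs_add_cons_append_iff, runs_cons_append_iff, runs_nil_iff] at h ⊢
  obtain ⟨A, X, Y, R, ht, hA, rfl, X', Y', R', hs, he, rfl⟩ := h
  rw [List.append_assoc] at he
  obtain ⟨M, rfl, rfl⟩ := exists_eq_append_of_append_eq_append he.symm
    (by rw [hs.length_ins, hA]; omega)
  have hM : M.length = d := by simpa [hs.length_ins] using hA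
  exact ⟨X', Y', M ++ X ++ R, hs, by simp, Y' ++ M, X, Y, R, ht, by simp [hs.length_outs, hM],
    by simp, by simp⟩

end Rewrites

/-! ### Words that represent the same braid -/

/-- The syntactic congruence of a function `f` on a monoid: `v` and `w` are related if replacing
`v` by `w` inside a product does not change the value of `f`. -/
def syntacticCon {M X : Type*} [Monoid M] (f : M → X) : Con M where
  r v w := ∀ p q, f (p * v * q) = f (p * w * q)
  iseqv := ⟨fun _ _ _ => rfl, fun h p q => (h p q).symm, fun h h' p q => (h p q).trans (h' p q)⟩
  mul' {v v' w w'} h h' p q := by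
    simpa only [mul_assoc] using (h p (w * q)).trans (by simpa only [mul_assoc] using h' (p * v') q)

theorem apply_eq_of_syntacticCon {M X : Type*} [Monoid M] {f : M → X} {v w : M}
    (h : syntacticCon f v w) : f v = f w := by
  simpa only [one_mul, mul_one] using h 1 1

section LetterUnit

variable {α : Type*} (c : Con (FreeMonoid (α × Bool)))
  (hc : ∀ a b, c (FreeMonoid.of (a, b) * FreeMonoid.of (a, !b)) 1)

/-- The class of a letter as a unit of a quotient of the monoid of words in which mutually inverse
letters cancel. -/
def letterUnit (a : α) : c.Quotientˣ where
  val := c.mk' (FreeMonoid.of (a, true))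
  inv := c.mk' (FreeMonoid.of (a, false))
  val_inv := (Con.eq c).2 (hc a true)
  inv_val := (Con.eq c).2 (hc a false)

theorem lift_letterUnit_mk (w : List (α × Bool)) :
    (FreeGroup.lift (letterUnit c hc) (FreeGroup.mk w) : c.Quotient) =
      c.mk' (FreeMonoid.ofList w) := by
  induction w with
  | nil => rfl
  | cons x w ih =>
    have hx : (FreeGroup.lift (letterUnit c hc) (FreeGroup.mk [x]) : c.Quotient) =
        c.mk' (FreeMonoid.of x) := by
      rcases x with ⟨a, _ | _⟩ <;>
        simp only [FreeGroup.lift_mk, List.map_cons, List.map_nil, List.prod_cons, List.prod_nil,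
          cond_false, cond_true, mul_one] <;>
        rfl
    calc (FreeGroup.lift (letterUnit c hc) (FreeGroup.mk (x :: w)) : c.Quotient)
        = FreeGroup.lift (letterUnit c hc) (FreeGroup.mk [x]) *
            FreeGroup.lift (letterUnit c hc) (FreeGroup.mk w) := by
          rw [← Units.val_mul, ← map_mul]; rfl
      _ = c.mk' (FreeMonoid.ofList (x :: w)) := by rw [hx, ih, ← map_mul]; rfl

end LetterUnit

variable {n : ℕ}

theorem exists_letterSlice_eq (x : Gen n × Bool) :
    ∃ (k : Kind) (i : ℕ), i + 2 ≤ n ∧ letterSlice x = ⟨.cross k, i⟩ := by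
  rcases x with ⟨⟨i, hi⟩ | ⟨i, hi⟩, _ | _⟩ <;> exact ⟨_, i, by omega, rfl⟩

/-- The closure of a word as a function on the monoid of braid words. -/
def closureLink (w : FreeMonoid (Gen n × Bool)) : FusedLink :=
  BraidWord.closure (n := n) w.toList |>.link

theorem syntacticCon_closureLink_of_rewrites {v w : FreeMonoid (Gen n × Bool)}
    (h : v.toList.map letterSlice ⇝ w.toList.map letterSlice) : syntacticCon closureLink v w := by
  intro p q
  have := (h.append_left (cups n ++ p.toList.map letterSlice)).append_right
    (q.toList.map letterSlice ++ caps n)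
  exact Rewrites.link_eq (by simpa [BraidWord.closure] using this)

theorem syntacticCon_closureLink_cancel (g : Gen n) (b : Bool) :
    syntacticCon closureLink (FreeMonoid.of (g, b) * FreeMonoid.of (g, !b)) 1 := by
  apply syntacticCon_closureLink_of_rewrites
  cases g <;> cases b <;> exact Rewrites.R2 _ _

/-- A generator as a unit of the monoid of braid words up to interchangeability in closures. -/
def genUnit (g : Gen n) : (syntacticCon (closureLink (n := n))).Quotientˣ :=
  letterUnit _ syntacticCon_closureLink_cancel g

theorem genUnit_commute_of_far {g h : Gen n} {k l : Kind} {i j : Fin (n - 1)}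
    (hg : letterSlice (g, true) = ⟨.cross k, i⟩) (hh : letterSlice (h, true) = ⟨.cross l, j⟩)
    (hij : Far i j) : genUnit g * genUnit h = genUnit h * genUnit g := by
  wlog hlt : (j : ℕ) + 2 ≤ i generalizing g h k l i j
  · exact (this hh hg hij.symm (hij.resolve_right hlt)).symm
  refine Units.ext ((Con.eq _).2 (syntacticCon_closureLink_of_rewrites ?_))
  change [letterSlice (g, true), letterSlice (h, true)] ⇝
    [letterSlice (h, true), letterSlice (g, true)]
  rw [hg, hh]
  exact Rewrites.exchange_symm _ _ hlt _ rfl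

theorem genUnit_triangle {a b c : Kind} {x y z x' y' z' : Gen n} {i j : Fin (n - 1)}
    (hij : (j : ℕ) = i + 1) (ht : a.Triangle b c)
    (hx : letterSlice (x, true) = ⟨.cross a, i⟩) (hy : letterSlice (y, true) = ⟨.cross b, j⟩)
    (hz : letterSlice (z, true) = ⟨.cross c, i⟩) (hz' : letterSlice (z', true) = ⟨.cross c, j⟩)
    (hy' : letterSlice (y', true) = ⟨.cross b, i⟩) (hx' : letterSlice (x', true) = ⟨.cross a, j⟩) :
    genUnit x * genUnit y * genUnit z = genUnit z' * genUnit y' * genUnit x' := by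
  refine Units.ext ((Con.eq _).2 (syntacticCon_closureLink_of_rewrites ?_))
  change [letterSlice (x, true), letterSlice (y, true), letterSlice (z, true)] ⇝
    [letterSlice (z', true), letterSlice (y', true), letterSlice (x', true)]
  rw [hx, hy, hz, hx', hy', hz', hij]
  exact Rewrites.R3 ht i

theorem lift_genUnit_eq_one_of_mem_relators :
    ∀ r ∈ relators n, FreeGroup.lift (genUnit (n := n)) r = 1 := by
  rintro r ⟨x, y, h, rfl⟩
  rw [map_mul, map_inv, mul_inv_eq_one]
  cases h <;> simp only [fσ, fρ, map_mul, map_one, FreeGroup.lift_apply_of]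
  case B1 h => exact genUnit_triangle h (.inl rfl) rfl rfl rfl rfl rfl rfl
  case P1 h => exact genUnit_triangle h (.inl rfl) rfl rfl rfl rfl rfl rfl
  case M2 h => exact genUnit_triangle h (.inl rfl) rfl rfl rfl rfl rfl rfl
  case F1 h => exact genUnit_triangle h (.inr (.inl rfl)) rfl rfl rfl rfl rfl rfl
  case F2 h => exact (genUnit_triangle h (.inl rfl) rfl rfl rfl rfl rfl rfl).symm
  case P3 i =>
    exact Units.ext ((Con.eq _).2 (syntacticCon_closureLink_of_rewrites (Rewrites.R2 .virt i)))
  all_goals exact genUnit_commute_of_far rfl rfl ‹_›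

theorem closure_link_eq_of_toUVB_eq {v w : BraidWord n} (h : v.toUVB = w.toUVB) :
    v.closure.link = w.closure.link := by
  have hvw : FreeGroup.lift (genUnit (n := n)) (FreeGroup.mk v) =
      FreeGroup.lift genUnit (FreeGroup.mk w) :=
    congrArg (PresentedGroup.toGroup lift_genUnit_eq_one_of_mem_relators) h
  refine apply_eq_of_syntacticCon (f := closureLink) (v := .ofList v) (w := .ofList w) ?_
  rw [← Con.eq, ← Con.coe_mk', ← lift_letterUnit_mk _ syntacticCon_closureLink_cancel,
    ← lift_letterUnit_mk _ syntacticCon_closureLink_cancel]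
  exact congrArg Units.val hvw

theorem toUVB_surjective : Function.Surjective (BraidWord.toUVB (n := n)) :=
  (PresentedGroup.mk_surjective _).comp Quot.mk_surjective

/-- The fused link that is represented by the closures of a braid. -/
noncomputable def fusedClosure (x : UVB n) : FusedLink :=
  (Function.surjInv toUVB_surjective x).closure.link

theorem fusedClosure_toUVB (w : BraidWord n) : fusedClosure w.toUVB = w.closure.link :=
  closure_link_eq_of_toUVB_eq (Function.surjInv_eq toUVB_surjective _)

theorem IsClosure.link_eq {x : UVB n} {D : Diagram} (h : IsClosure x D) :
    D.link = fusedClosure x := by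
  obtain ⟨w, rfl, rfl⟩ := h
  exact (fusedClosure_toUVB w).symm

/-! ### Conjugation -/

theorem cups_succ (n : ℕ) : cups (n + 1) = cups n ++ [⟨.cup true, n⟩] := by
  simp [cups, List.range_succ]

theorem caps_succ (n : ℕ) : caps (n + 1) = [⟨.cap, n⟩] ++ caps n := by
  simp [caps, List.range_succ]

theorem Kind.swap_swap (k : Kind) : k.swap.swap = k := by
  cases k <;> rfl

namespace Rewrites

theorem cup_cup_cross (k : Kind) (i : ℕ) :
    [⟨.cup true, i⟩, ⟨.cup true, i + 1⟩, ⟨.cross k, i⟩] ⇝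
      [⟨.cup true, i⟩, ⟨.cup true, i + 1⟩, ⟨.cross k, i + 2⟩] := calc
  [⟨.cup true, i⟩, ⟨.cup true, i + 1⟩, ⟨.cross k, i⟩]
    ⇝ [⟨.cup true, i⟩, ⟨.cup true, i⟩, ⟨.cross k.swap, i + 1⟩] := by
      simpa only [Kind.swap_swap, List.cons_append, List.nil_append] using
        (slide_cup_symm true k.swap i).append_left [⟨.cup true, i⟩]
  _ ⇝ [⟨.cup true, i⟩, ⟨.cup true, i + 2⟩, ⟨.cross k.swap, i + 1⟩] :=
      (exchange_symm (.cup true) (.cup true) le_rfl _ rfl).append_right [⟨.cross k.swap, i + 1⟩]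
  _ ⇝ [⟨.cup true, i⟩, ⟨.cup true, i + 1⟩, ⟨.cross k, i + 2⟩] :=
      (slide_cup_symm true k (i + 1)).append_left [⟨.cup true, i⟩]

theorem cross_cap_cap (k : Kind) (i : ℕ) :
    [⟨.cross k, i + 2⟩, ⟨.cap, i + 1⟩, ⟨.cap, i⟩] ⇝
      [⟨.cross k, i⟩, ⟨.cap, i + 1⟩, ⟨.cap, i⟩] := calc
  [⟨.cross k, i + 2⟩, ⟨.cap, i + 1⟩, ⟨.cap, i⟩]
    ⇝ [⟨.cross k.swap, i + 1⟩, ⟨.cap, i + 2⟩, ⟨.cap, i⟩] := by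
      simpa only [Kind.swap_swap, List.cons_append, List.nil_append] using
        (slide_cap_symm k.swap (i + 1)).append_right [⟨.cap, i⟩]
  _ ⇝ [⟨.cross k.swap, i + 1⟩, ⟨.cap, i⟩, ⟨.cap, i⟩] :=
      (exchange_symm .cap .cap le_rfl _ rfl).append_left [⟨.cross k.swap, i + 1⟩]
  _ ⇝ [⟨.cross k, i⟩, ⟨.cap, i + 1⟩, ⟨.cap, i⟩] :=
      (slide_cap_symm k i).append_right [⟨.cap, i⟩]

theorem cups_cross (k : Kind) (i r : ℕ) :
    cups (i + 2 + r) ++ [⟨.cross k, i⟩] ⇝ cups (i + 2 + r) ++ [⟨.cross k, i + 2 + 2 * r⟩] := by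
  induction r with
  | zero => simpa [cups_succ] using (cup_cup_cross k i).append_left (cups i)
  | succ r ih =>
    have hl := exchange_symm (.cross k) (.cup true) (Nat.le_add_right (i + 2) r) (i + 2 + r) rfl
    have hr := exchange_symm (.cup true) (.cross k) (i := i + 2 + r) (j := i + 2 + 2 * r)
      (by simp only [Piece.ins]; omega) (i + 2 + 2 * (r + 1))
      (by simp only [Piece.ins, Piece.outs]; omega)
    rw [← add_assoc, cups_succ, List.append_assoc, List.append_assoc]
    exact ((hl.append_left _).trans (by simpa using ih.append_right _)).trans (hr.append_left _)

theorem cross_caps (k : Kind) (i r : ℕ) :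
    ⟨.cross k, i + 2 + 2 * r⟩ :: caps (i + 2 + r) ⇝ ⟨.cross k, i⟩ :: caps (i + 2 + r) := by
  induction r with
  | zero => simpa [caps_succ] using (cross_cap_cap k i).append_right (caps i)
  | succ r ih =>
    have hl := exchange_symm .cap (.cross k) (i := i + 2 + r) (j := i + 2 + 2 * (r + 1))
      (by simp only [Piece.ins]; omega) (i + 2 + 2 * r)
      (by simp only [Piece.ins, Piece.outs]; omega)
    have hr := exchange_symm (.cross k) .cap (Nat.le_add_right (i + 2) r) (i + 2 + r) rfl
    rw [← add_assoc, caps_succ]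
    exact ((hl.append_right _).trans (ih.append_left [_])).trans (hr.append_right _)

theorem cons_letters (p : Piece) {j : ℕ} (hj : n ≤ j) (w : BraidWord n) :
    ⟨p, j⟩ :: w.map letterSlice ⇝ w.map letterSlice ++ [⟨p, j⟩] := by
  induction w with
  | nil => exact refl _
  | cons x w ih =>
    obtain ⟨k, i, hi, hx⟩ := exists_letterSlice_eq x
    rw [List.map_cons, hx]
    exact ((exchange_symm (.cross k) p (hi.trans hj) j rfl).append_right _).trans
      (ih.append_left [_])

theorem closure_cons (x : Gen n × Bool) (w : BraidWord n) :
    (BraidWord.closure (x :: w)).word ⇝ (BraidWord.closure (w ++ [x])).word := by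
  obtain ⟨k, i, hi, hx⟩ := exists_letterSlice_eq x
  obtain ⟨r, rfl⟩ := Nat.exists_eq_add_of_le hi
  simp only [BraidWord.closure, List.map_append, List.map_cons, List.map_nil, hx]
  set W := w.map letterSlice
  calc cups (i + 2 + r) ++ ⟨.cross k, i⟩ :: W ++ caps (i + 2 + r)
    _ ⇝ cups (i + 2 + r) ++ (⟨.cross k, i + 2 + 2 * r⟩ :: W) ++ caps (i + 2 + r) := by
      simpa using (cups_cross k i r).append_right (W ++ caps (i + 2 + r))
    _ ⇝ cups (i + 2 + r) ++ (W ++ [⟨.cross k, i + 2 + 2 * r⟩]) ++ caps (i + 2 + r) :=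
      ((cons_letters (.cross k) (by omega) w).append_left _).append_right _
    _ ⇝ cups (i + 2 + r) ++ (W ++ [⟨.cross k, i⟩]) ++ caps (i + 2 + r) := by
      simpa using (cross_caps k i r).append_left (cups (i + 2 + r) ++ W)

end Rewrites

theorem closure_append_link (v w : BraidWord n) :
    (BraidWord.closure (v ++ w)).link = (BraidWord.closure (w ++ v)).link := by
  induction v generalizing w with
  | nil => simp
  | cons x v ih =>
    calc (BraidWord.closure (x :: (v ++ w))).link
        = (BraidWord.closure (v ++ (w ++ [x]))).link := by
          rw [← List.append_assoc]; exact (Rewrites.closure_cons x (v ++ w)).link_eq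
      _ = (BraidWord.closure (w ++ x :: v)).link := by simpa using ih (w ++ [x])

theorem fusedClosure_mul_comm (x y : UVB n) : fusedClosure (x * y) = fusedClosure (y * x) := by
  obtain ⟨v, rfl⟩ := toUVB_surjective x
  obtain ⟨w, rfl⟩ := toUVB_surjective y
  exact (fusedClosure_toUVB (v ++ w)).trans
    ((closure_append_link v w).trans (fusedClosure_toUVB (w ++ v)).symm)

theorem fusedClosure_conj (g x : UVB n) : fusedClosure (g * x * g⁻¹) = fusedClosure x := by
  rw [fusedClosure_mul_comm, inv_mul_cancel_left]

/-! ### Adding a strand -/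

/-- The generators of the braids on `n` strands as braids on `n + 1` strands. -/
def Gen.succ : Gen n → Gen (n + 1)
  | .sigma i => .sigma ⟨i, by omega⟩
  | .rho i => .rho ⟨i, by omega⟩

theorem Rel.succ {x y : FreeGroup (Gen n)} (h : Rel n x y) :
    Rel (n + 1) (FreeGroup.map Gen.succ x) (FreeGroup.map Gen.succ y) := by
  cases h <;> simp only [fσ, fρ, map_mul, map_one, FreeGroup.map.of, Gen.succ]
  case B1 h => exact .B1 _ _ h
  case B2 h => exact .B2 _ _ h
  case P1 h => exact .P1 _ _ h
  case P2 h => exact .P2 _ _ h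
  case P3 => exact .P3 _
  case M1 h => exact .M1 _ _ h
  case M2 h => exact .M2 _ _ h
  case F1 h => exact .F1 _ _ h
  case F2 h => exact .F2 _ _ h

theorem mk_eq_mk_of_rel {x y : FreeGroup (Gen n)} (h : Rel n x y) :
    PresentedGroup.mk (relators n) x = PresentedGroup.mk (relators n) y :=
  PresentedGroup.mk_eq_mk_of_mul_inv_mem ⟨x, y, h, rfl⟩

theorem lift_of_succ (x : FreeGroup (Gen n)) :
    FreeGroup.lift (fun g => (PresentedGroup.of g.succ : UVB (n + 1))) x =
      PresentedGroup.mk (relators (n + 1)) (FreeGroup.map Gen.succ x) :=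
  (FreeGroup.lift_unique ((PresentedGroup.mk (relators (n + 1))).comp (FreeGroup.map Gen.succ))
    fun _ => by simp [PresentedGroup.of]).symm

theorem lift_of_succ_eq_one_of_mem_relators : ∀ r ∈ relators n,
    FreeGroup.lift (fun g => (PresentedGroup.of g.succ : UVB (n + 1))) r = 1 := by
  rintro r ⟨x, y, h, rfl⟩
  rw [map_mul, map_inv, mul_inv_eq_one, lift_of_succ, lift_of_succ]
  exact mk_eq_mk_of_rel h.succ

/-- The homomorphism `UVB_n → UVB_{n+1}` that adds a strand on the right. -/
def addStrand : UVB n →* UVB (n + 1) :=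
  PresentedGroup.toGroup lift_of_succ_eq_one_of_mem_relators

theorem addStrand_of (g : Gen n) :
    addStrand (PresentedGroup.of g : UVB n) = PresentedGroup.of g.succ :=
  PresentedGroup.toGroup.of lift_of_succ_eq_one_of_mem_relators

theorem addStrand_toUVB (w : BraidWord n) :
    addStrand w.toUVB = BraidWord.toUVB (w.map fun x => (x.1.succ, x.2)) :=
  lift_of_succ (FreeGroup.mk w)

/-! ### Stabilization -/

theorem Rewrites.cup_virt_cap (i : ℕ) :
    [⟨.cup true, i + 1⟩, ⟨.cross .virt, i⟩, ⟨.cap, i + 1⟩] ⇝ [] := calc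
  [⟨.cup true, i + 1⟩, ⟨.cross .virt, i⟩, ⟨.cap, i + 1⟩]
    ⇝ [⟨.cup true, i⟩, ⟨.cross .virt, i + 1⟩, ⟨.cap, i + 1⟩] :=
      (slide_cup_symm true .virt i).append_right [⟨.cap, i + 1⟩]
  _ ⇝ [⟨.cup true, i⟩, ⟨.cap, i + 1⟩] := (R1_cap .virt (i + 1)).append_left [⟨.cup true, i⟩]
  _ ⇝ [] := zigzag_right true i

theorem map_letterSlice_succ (w : BraidWord n) :
    (w.map fun x => (x.1.succ, x.2)).map letterSlice = w.map letterSlice := by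
  rw [List.map_map]
  exact List.map_congr_left fun x _ => by rcases x with ⟨_ | _, _ | _⟩ <;> rfl

theorem fusedClosure_addStrand_mul_rho (x : UVB n) (i : Fin (n + 1 - 1))
    (hi : (i : ℕ) + 1 = n) :
    fusedClosure (addStrand x * (PresentedGroup.of (Gen.rho i) : UVB (n + 1))) =
      fusedClosure x := by
  obtain ⟨w, rfl⟩ := toUVB_surjective x
  have hw : addStrand w.toUVB * PresentedGroup.of (Gen.rho i) = BraidWord.toUVB
      (w.map (fun x => (x.1.succ, x.2)) ++ [(Gen.rho i, true)]) := by
    rw [addStrand_toUVB]; rfl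
  rw [hw, fusedClosure_toUVB, fusedClosure_toUVB]
  apply Rewrites.link_eq
  simp only [BraidWord.closure, List.map_append, map_letterSlice_succ, cups_succ, caps_succ]
  set W := w.map letterSlice
  calc cups n ++ [⟨.cup true, n⟩] ++ (W ++ [⟨.cross .virt, i⟩]) ++ ([⟨.cap, n⟩] ++ caps n)
    _ ⇝ cups n ++ W ++ [⟨.cup true, n⟩, ⟨.cross .virt, i⟩, ⟨.cap, n⟩] ++ caps n := by
      simpa using ((Rewrites.cons_letters (.cup true) le_rfl w).append_left (cups n)).append_right
        (⟨.cross .virt, i⟩ :: ⟨.cap, n⟩ :: caps n)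
    _ ⇝ cups n ++ W ++ caps n := by
      have := ((Rewrites.cup_virt_cap i).append_left (cups n ++ W)).append_right (caps n)
      simpa only [hi, List.append_nil] using this

/-! ### The symmetric group -/

section Coxeter

variable {G : Type*} [Group G]

/-- The elements `s 0, …, s (n - 1)` of a group satisfy the Coxeter relations of type `A_n`. -/
structure IsCoxeterA (s : ℕ → G) (n : ℕ) : Prop where
  mul_self {i : ℕ} (h : i < n) : s i * s i = 1
  commute {i j : ℕ} (hij : i + 2 ≤ j) (h : j < n) : Commute (s i) (s j)
  braid {i : ℕ} (h : i + 1 < n) : s i * s (i + 1) * s i = s (i + 1) * s i * s (i + 1)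

/-- The descending product `s (k + t - 1) * ⋯ * s k`. -/
def descProd (s : ℕ → G) : ℕ → ℕ → G
  | _, 0 => 1
  | k, t + 1 => descProd s (k + 1) t * s k

namespace IsCoxeterA

variable {s : ℕ → G}

theorem mono {m : ℕ} (hs : IsCoxeterA s n) (h : m ≤ n) : IsCoxeterA s m where
  mul_self hi := hs.mul_self (hi.trans_le h)
  commute hij hj := hs.commute hij (hj.trans_le h)
  braid hi := hs.braid (hi.trans_le h)

theorem commute_descProd (hs : IsCoxeterA s n) {i k t : ℕ} (hik : i + 2 ≤ k) (ht : k + t ≤ n) :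
    Commute (s i) (descProd s k t) := by
  induction t generalizing k with
  | zero => exact Commute.one_right _
  | succ t ih => exact (ih (by omega) (by omega)).mul_right (hs.commute hik (by omega))

theorem descProd_mul (hs : IsCoxeterA s n) {i k t : ℕ} (hki : k ≤ i) (hi : i + 1 < k + t)
    (ht : k + t ≤ n) : descProd s k t * s (i + 1) = s i * descProd s k t := by
  induction t generalizing k with
  | zero => omega
  | succ t ih =>
    rcases hki.lt_or_eq with hlt | rfl
    · rw [descProd, mul_assoc, (hs.commute (by omega : k + 2 ≤ i + 1) (by omega)).eq, ← mul_assoc,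
        ih hlt (by omega) (by omega), mul_assoc]
    · obtain ⟨t, rfl⟩ : ∃ t', t = t' + 1 := ⟨t - 1, by omega⟩
      have hcomm : Commute (s k) (descProd s (k + 2) t) := hs.commute_descProd le_rfl (by omega)
      calc descProd s (k + 2) t * s (k + 1) * s k * s (k + 1)
          = descProd s (k + 2) t * (s (k + 1) * s k * s (k + 1)) := by simp only [mul_assoc]
        _ = descProd s (k + 2) t * s k * (s (k + 1) * s k) := by
            rw [← hs.braid (by omega)]; simp only [mul_assoc]
        _ = s k * (descProd s (k + 2) t * s (k + 1) * s k) := by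
            rw [← hcomm.eq]; simp only [mul_assoc]

theorem exists_descProd_mul_eq (hs : IsCoxeterA s (n + 1)) {i k t : ℕ} (hi : i < n + 1)
    (hkt : k + t = n + 1) : ∃ y ∈ Subgroup.closure (s '' Set.Iio n), ∃ k' t', k' + t' = n + 1 ∧
      descProd s k t * s i = y * descProd s k' t' := by
  have hmem {j : ℕ} (hj : j < n) : s j ∈ Subgroup.closure (s '' Set.Iio n) :=
    Subgroup.subset_closure ⟨j, hj, rfl⟩
  obtain h | rfl | rfl | h : i + 2 ≤ k ∨ k = i + 1 ∨ k = i ∨ k < i := by omega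
  · exact ⟨s i, hmem (by omega), k, t, hkt, (hs.commute_descProd h hkt.le).eq.symm⟩
  · exact ⟨1, one_mem _, i, t + 1, by omega, by rw [one_mul, descProd]⟩
  · obtain ⟨t, rfl⟩ : ∃ t', t = t' + 1 := ⟨t - 1, by omega⟩
    refine ⟨1, one_mem _, k + 1, t, by omega, ?_⟩
    rw [descProd, mul_assoc, hs.mul_self hi, mul_one, one_mul]
  · obtain ⟨i, rfl⟩ : ∃ i', i = i' + 1 := ⟨i - 1, by omega⟩
    exact ⟨s i, hmem (by omega), k, t, hkt, hs.descProd_mul (by omega) (by omega) hkt.le⟩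

theorem exists_eq_mul_descProd (hs : IsCoxeterA s (n + 1)) {x : G}
    (hx : x ∈ Subgroup.closure (s '' Set.Iio (n + 1))) :
    ∃ y ∈ Subgroup.closure (s '' Set.Iio n), ∃ k t, k + t = n + 1 ∧ x = y * descProd s k t := by
  have hmul {x : G} {i : ℕ} (hi : i < n + 1)
      (h : ∃ y ∈ Subgroup.closure (s '' Set.Iio n), ∃ k t, k + t = n + 1 ∧
        x = y * descProd s k t) :
      ∃ y ∈ Subgroup.closure (s '' Set.Iio n), ∃ k t, k + t = n + 1 ∧
        x * s i = y * descProd s k t := by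
    obtain ⟨y, hy, k, t, hkt, rfl⟩ := h
    obtain ⟨z, hz, k', t', hkt', h⟩ := hs.exists_descProd_mul_eq hi hkt
    exact ⟨y * z, mul_mem hy hz, k', t', hkt', by rw [mul_assoc, h, mul_assoc]⟩
  induction hx using Subgroup.closure_induction_right with
  | one => exact ⟨1, one_mem _, n + 1, 0, rfl, by rw [descProd, one_mul]⟩
  | mul_right x _ y hy ih =>
    obtain ⟨i, hi, rfl⟩ := hy
    exact hmul hi ih
  | mul_inv_cancel x _ y hy ih =>
    obtain ⟨i, hi, rfl⟩ := hy
    rw [inv_eq_of_mul_eq_one_right (hs.mul_self hi)]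
    exact hmul hi ih

end IsCoxeterA

variable {s : ℕ → G} {f : G →* Equiv.Perm ℕ}

theorem apply_descProd_apply (hf : ∀ i < n, f (s i) = Equiv.swap i (i + 1)) {k t : ℕ}
    (h : k + t ≤ n) : f (descProd s k t) k = k + t := by
  induction t generalizing k with
  | zero => simp [descProd]
  | succ t ih =>
    rw [descProd, map_mul, Equiv.Perm.mul_apply, hf k (by omega), Equiv.swap_apply_left,
      ih (by omega)]
    omega

theorem apply_apply_of_mem_closure (hf : ∀ i < n, f (s i) = Equiv.swap i (i + 1)) {x : G}
    (hx : x ∈ Subgroup.closure (s '' Set.Iio n)) {j : ℕ} (hj : n < j) : f x j = j := by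
  have hle : Subgroup.closure (s '' Set.Iio n) ≤
      (MulAction.stabilizer (Equiv.Perm ℕ) j).comap f := by
    rw [Subgroup.closure_le]
    rintro _ ⟨i, hi, rfl⟩
    have hij : i < n := hi
    exact (DFunLike.congr_fun (hf i hi) j).trans
      (Equiv.swap_apply_of_ne_of_ne (by omega) (by omega))
  exact hle hx

theorem IsCoxeterA.eq_one_of_mem_closure (hs : IsCoxeterA s n)
    (hf : ∀ i < n, f (s i) = Equiv.swap i (i + 1)) {x : G}
    (hx : x ∈ Subgroup.closure (s '' Set.Iio n)) (hfx : f x = 1) : x = 1 := by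
  induction n generalizing x with
  | zero => simpa using hx
  | succ n ih =>
    have hf' : ∀ i < n, f (s i) = Equiv.swap i (i + 1) := fun i hi => hf i (by omega)
    obtain ⟨y, hy, k, t, hkt, rfl⟩ := hs.exists_eq_mul_descProd hx
    have hk : k = n + 1 := calc
      k = f (y * descProd s k t) k := by rw [hfx, Equiv.Perm.one_apply]
      _ = f y (n + 1) := by
        rw [map_mul, Equiv.Perm.mul_apply, apply_descProd_apply hf hkt.le, hkt]
      _ = n + 1 := apply_apply_of_mem_closure hf' hy (Nat.lt_succ_self n)
    obtain rfl : t = 0 := by omega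
    rw [descProd, mul_one] at hfx ⊢
    exact ih (hs.mono (Nat.le_succ n)) hf' hy hfx

end Coxeter

theorem viaEmbeddingHom_swap {X Y : Type*} [DecidableEq X] [DecidableEq Y] (e : X ↪ Y) (i j : X) :
    Equiv.Perm.viaEmbeddingHom e (Equiv.swap i j) = Equiv.swap (e i) (e j) := by
  rw [Equiv.Perm.viaEmbeddingHom_apply]
  ext y : 1
  by_cases hy : y ∈ Set.range e
  · obtain ⟨x, rfl⟩ := hy
    rw [Equiv.Perm.viaEmbedding_apply, e.injective.swap_apply]
  · rw [Equiv.Perm.viaEmbedding_apply_of_notMem _ _ _ hy, Equiv.swap_apply_of_ne_of_ne]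
    · exact fun h => hy ⟨i, h.symm⟩
    · exact fun h => hy ⟨j, h.symm⟩

/-- The first of the two strands of `σ_i`. -/
def leftStrand (i : Fin (n - 1)) : Fin n := ⟨i, by omega⟩

/-- The second of the two strands of `σ_i`. -/
def rightStrand (i : Fin (n - 1)) : Fin n := ⟨i + 1, by omega⟩

theorem iota_of (g : Gen n) : iota n (PresentedGroup.of g) = genPerm g :=
  PresentedGroup.toGroup.of genPerm_relators

/-- The extension of permutations of `n` points to `n + 1` points that fixes the last one. -/
noncomputable def permCastSucc : Equiv.Perm (Fin n) →* Equiv.Perm (Fin (n + 1)) :=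
  Equiv.Perm.viaEmbeddingHom Fin.castSuccEmb

theorem permCastSucc_castSucc (g : Equiv.Perm (Fin n)) (i : Fin n) :
    permCastSucc g i.castSucc = (g i).castSucc :=
  Equiv.Perm.viaEmbedding_apply g Fin.castSuccEmb i

theorem permCastSucc_last (g : Equiv.Perm (Fin n)) : permCastSucc g (Fin.last n) = Fin.last n :=
  Equiv.Perm.viaEmbedding_apply_of_notMem g Fin.castSuccEmb _ (by
    rintro ⟨i, hi⟩
    exact i.castSucc_lt_last.ne hi)

theorem iota_comp_addStrand : (iota (n + 1)).comp addStrand = permCastSucc.comp (iota n) := by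
  ext1 g
  simp only [MonoidHom.comp_apply, addStrand_of, iota_of]
  cases g <;> exact (viaEmbeddingHom_swap Fin.castSuccEmb (leftStrand _) (rightStrand _)).symm

/-! ### The symmetric group in `UVB_n` -/

/-- The generator `ρ_i`, or `1` if there is no generator with this index. -/
def rhoNat (n i : ℕ) : UVB n :=
  if h : i < n - 1 then PresentedGroup.of (Gen.rho ⟨i, h⟩) else 1

theorem rhoNat_of_lt {i : ℕ} (h : i < n - 1) :
    rhoNat n i = PresentedGroup.of (Gen.rho ⟨i, h⟩) := dif_pos h

theorem isCoxeterA_rhoNat : IsCoxeterA (rhoNat n) (n - 1) where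
  mul_self h := by
    rw [rhoNat_of_lt h]
    exact mk_eq_mk_of_rel (.P3 _)
  commute hij h := by
    rw [rhoNat_of_lt h, rhoNat_of_lt (by omega)]
    exact mk_eq_mk_of_rel (.P2 _ _ (.inl hij))
  braid h := by
    rw [rhoNat_of_lt h, rhoNat_of_lt (by omega)]
    exact mk_eq_mk_of_rel (.P1 _ _ rfl)

theorem symmSubgroup_le_closure_rhoNat :
    symmSubgroup n ≤ Subgroup.closure (rhoNat n '' Set.Iio (n - 1)) := by
  refine Subgroup.closure_mono ?_
  rintro _ ⟨i, rfl⟩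
  exact ⟨i, i.2, rhoNat_of_lt i.2⟩

theorem eq_one_of_mem_symmSubgroup {x : UVB n} (hx : x ∈ symmSubgroup n) (h : iota n x = 1) :
    x = 1 := by
  refine isCoxeterA_rhoNat.eq_one_of_mem_closure
    (f := (Equiv.Perm.viaEmbeddingHom Fin.valEmbedding).comp (iota n)) (fun i hi => ?_)
    (symmSubgroup_le_closure_rhoNat hx) (by rw [MonoidHom.comp_apply, h, map_one])
  rw [rhoNat_of_lt hi, MonoidHom.comp_apply, iota_of]
  exact viaEmbeddingHom_swap _ _ _

theorem map_iota_symmSubgroup (n : ℕ) : (symmSubgroup n).map (iota n) = ⊤ := by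
  rcases n with _ | n
  · exact Subsingleton.elim _ _
  · rw [← top_le_iff, ← Subgroup.toSubmonoid_le, Subgroup.top_toSubmonoid,
      ← Equiv.Perm.mclosure_swap_castSucc_succ n, Submonoid.closure_le]
    rintro _ ⟨i, rfl⟩
    exact ⟨_, Subgroup.subset_closure ⟨i, rfl⟩, iota_of _⟩

theorem bijective_iota_symmSubgroup (n : ℕ) :
    Function.Bijective ((iota n).comp (symmSubgroup n).subtype) := by
  constructor
  · rw [injective_iff_map_eq_one]
    rintro ⟨x, hx⟩ h
    exact Subtype.ext (eq_one_of_mem_symmSubgroup hx h)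
  · intro g
    obtain ⟨x, hx, rfl⟩ : g ∈ (symmSubgroup n).map (iota n) :=
      map_iota_symmSubgroup n ▸ Subgroup.mem_top g
    exact ⟨⟨x, hx⟩, rfl⟩

/-- The embedding `S_n → UVB_n` with `τ_i ↦ ρ_i`. -/
noncomputable def permBraid : Equiv.Perm (Fin n) →* UVB n :=
  (symmSubgroup n).subtype.comp
    (MulEquiv.ofBijective _ (bijective_iota_symmSubgroup n)).symm.toMonoidHom

theorem permBraid_mem (g : Equiv.Perm (Fin n)) : permBraid g ∈ symmSubgroup n :=
  Subtype.prop _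

theorem iota_permBraid (g : Equiv.Perm (Fin n)) : iota n (permBraid g) = g :=
  (MulEquiv.ofBijective _ (bijective_iota_symmSubgroup n)).apply_symm_apply g

theorem permBraid_iota {x : UVB n} (hx : x ∈ symmSubgroup n) : permBraid (iota n x) = x :=
  congrArg Subtype.val
    ((MulEquiv.ofBijective _ (bijective_iota_symmSubgroup n)).symm_apply_apply ⟨x, hx⟩)

theorem permBraid_tau (i : Fin (n - 1)) : permBraid (tau i) = PresentedGroup.of (Gen.rho i) :=
  (congrArg permBraid (iota_of (Gen.rho i)).symm).trans
    (permBraid_iota (Subgroup.subset_closure ⟨i, rfl⟩))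

theorem map_addStrand_symmSubgroup_le :
    (symmSubgroup n).map addStrand ≤ symmSubgroup (n + 1) := by
  rw [symmSubgroup, MonoidHom.map_closure, Subgroup.closure_le]
  rintro _ ⟨_, ⟨i, rfl⟩, rfl⟩
  exact Subgroup.subset_closure ⟨⟨i, by omega⟩, (addStrand_of (Gen.rho i)).symm⟩

theorem addStrand_permBraid (g : Equiv.Perm (Fin n)) :
    addStrand (permBraid g) = permBraid (permCastSucc g) := by
  have hmem : addStrand (permBraid g) ∈ symmSubgroup (n + 1) :=
    map_addStrand_symmSubgroup_le ⟨_, permBraid_mem g, rfl⟩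
  have hiota := DFunLike.congr_fun iota_comp_addStrand (permBraid g)
  simp only [MonoidHom.comp_apply, iota_permBraid] at hiota
  rw [← hiota, permBraid_iota hmem]

/-! ### Cutting a strand -/

theorem swap_castSucc_last_eq (i : Fin (n + 1)) :
    Equiv.swap i.castSucc (Fin.last (n + 1)) =
      permCastSucc (Equiv.swap (Fin.last n) i) * tau (n := n + 2) (Fin.last n) *
        (permCastSucc (Equiv.swap (Fin.last n) i))⁻¹ := by
  rw [show tau (n := n + 2) (Fin.last n) = Equiv.swap (Fin.last n).castSucc (Fin.last (n + 1))
    from rfl, ← Equiv.swap_apply_apply, permCastSucc_castSucc, permCastSucc_last,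
    Equiv.swap_apply_left]

theorem fusedClosure_cut (x y : UVB n) (i : Fin n) :
    fusedClosure (addStrand x * permBraid (Equiv.swap i.castSucc (Fin.last n)) * addStrand y) =
      fusedClosure (x * y) := by
  obtain ⟨n, rfl⟩ : ∃ m, n = m + 1 := ⟨n - 1, by have := i.2; omega⟩
  set g := permBraid (Equiv.swap (Fin.last n) i)
  have hswap : permBraid (Equiv.swap i.castSucc (Fin.last (n + 1))) =
      addStrand g * PresentedGroup.of (Gen.rho (Fin.last n)) * (addStrand g)⁻¹ := by
    rw [swap_castSucc_last_eq, map_mul, map_mul, map_inv, ← addStrand_permBraid, permBraid_tau]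
  calc fusedClosure (addStrand x * permBraid (Equiv.swap i.castSucc (Fin.last (n + 1))) *
          addStrand y)
      = fusedClosure (addStrand (x * g) * PresentedGroup.of (Gen.rho (Fin.last n)) *
          addStrand (g⁻¹ * y)) := by
        simp only [hswap, map_mul, map_inv, mul_assoc]
    _ = fusedClosure (addStrand (g⁻¹ * y * (x * g)) *
          PresentedGroup.of (Gen.rho (Fin.last n))) := by
        rw [fusedClosure_mul_comm, map_mul _ (g⁻¹ * y), mul_assoc]
    _ = fusedClosure (g⁻¹ * y * (x * g)) := fusedClosure_addStrand_mul_rho _ _ rfl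
    _ = fusedClosure (x * y) := by rw [fusedClosure_mul_comm]; group

/-! ### The generators of the pure group -/

/-- The element `σ_i ρ_i` of the pure group. -/
def pureGen (i : Fin (n - 1)) : UVB n :=
  PresentedGroup.of (Gen.sigma i) * PresentedGroup.of (Gen.rho i)

theorem commute_rho_pureGen {i j : Fin (n - 1)} (h : Far i j) :
    Commute (PresentedGroup.of (Gen.rho j)) (pureGen i) :=
  .mul_right (mk_eq_mk_of_rel (.M1 i j h)).symm (mk_eq_mk_of_rel (.P2 i j h)).symm

theorem commute_pureGen_pureGen {i j : Fin (n - 1)} (h : Far i j) :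
    Commute (pureGen j) (pureGen i) := by
  refine .mul_left (.mul_right ?_ ?_) (commute_rho_pureGen h)
  · exact (mk_eq_mk_of_rel (.B2 i j h)).symm
  · exact mk_eq_mk_of_rel (.M1 j i h.symm)

theorem addStrand_pureGen (i : Fin (n - 1)) :
    addStrand (pureGen i) = pureGen (n := n + 1) ⟨i, by omega⟩ := by
  rw [pureGen, map_mul, addStrand_of, addStrand_of]
  rfl

theorem tau_leftStrand (i : Fin (n - 1)) : tau i (leftStrand i) = rightStrand i :=
  Equiv.swap_apply_left _ _

theorem tau_rightStrand (i : Fin (n - 1)) : tau i (rightStrand i) = leftStrand i :=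
  Equiv.swap_apply_right _ _

theorem tau_apply_of_ne_of_ne {i : Fin (n - 1)} {x : Fin n} (h : (x : ℕ) ≠ i)
    (h' : (x : ℕ) ≠ i + 1) : tau i x = x :=
  Equiv.swap_apply_of_ne_of_ne (fun hx => h (congrArg Fin.val hx))
    (fun hx => h' (congrArg Fin.val hx))

theorem leftStrand_ne_rightStrand (i : Fin (n - 1)) : leftStrand i ≠ rightStrand i :=
  fun h => by simpa [leftStrand, rightStrand] using congrArg Fin.val h

theorem rightStrand_eq_leftStrand {i j : Fin (n - 1)} (h : (j : ℕ) = i + 1) :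
    rightStrand i = leftStrand j :=
  Fin.ext h.symm

theorem tau_mul_tau_leftStrand {i j : Fin (n - 1)} (h : (j : ℕ) = i + 1) :
    (tau i * tau j) (leftStrand i) = leftStrand j := by
  rw [Equiv.Perm.mul_apply, tau_apply_of_ne_of_ne (i := j), tau_leftStrand,
    rightStrand_eq_leftStrand h]
  all_goals simp only [leftStrand]; omega

theorem tau_mul_tau_rightStrand {i j : Fin (n - 1)} (h : (j : ℕ) = i + 1) :
    (tau i * tau j) (rightStrand i) = rightStrand j := by
  rw [Equiv.Perm.mul_apply, rightStrand_eq_leftStrand h, tau_leftStrand, tau_apply_of_ne_of_ne]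
  all_goals simp only [rightStrand]; omega

theorem mem_orbit_closure_tau {m : ℕ} (x : ℕ) (hmx : m ≤ x) (hx : x < n) :
    (⟨x, hx⟩ : Fin n) ∈ MulAction.orbit (Subgroup.closure (tau '' {j : Fin (n - 1) | m ≤ j}))
      ⟨m, hmx.trans_lt hx⟩ := by
  induction x, hmx using Nat.le_induction with
  | base => exact MulAction.mem_orbit_self _
  | succ x hmx ih =>
    let j : Fin (n - 1) := ⟨x, by omega⟩
    have hmem := MulAction.mem_orbit_of_mem_orbit
      (⟨tau j, Subgroup.subset_closure ⟨j, hmx, rfl⟩⟩ :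
        Subgroup.closure (tau '' {j : Fin (n - 1) | m ≤ j})) (ih (by omega))
    have htau : tau j ⟨x, by omega⟩ = ⟨x + 1, hx⟩ := tau_leftStrand j
    rwa [Subgroup.mk_smul, Equiv.Perm.smul_def, htau] at hmem

theorem mem_closure_tau {m : ℕ} {g : Equiv.Perm (Fin n)}
    (hg : ∀ x : Fin n, (x : ℕ) < m → g x = x) :
    g ∈ Subgroup.closure (tau '' {j : Fin (n - 1) | m ≤ j}) := by
  refine (mem_closure_isSwap ?_).2 ⟨Set.toFinite _, fun x => ?_⟩
  · rintro _ ⟨j, -, rfl⟩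
    exact ⟨_, _, leftStrand_ne_rightStrand j, rfl⟩
  · by_cases hx : (x : ℕ) < m
    · rw [hg x hx]
      exact MulAction.mem_orbit_self _
    · have hgx : ¬(g x : ℕ) < m := fun h => hx (by rwa [g.injective (hg _ h)] at h)
      rw [MulAction.orbit_eq_iff.2 (mem_orbit_closure_tau x (not_lt.1 hx) x.2)]
      exact mem_orbit_closure_tau _ (not_lt.1 hgx) (g x).2

theorem commute_permBraid_pureGen_of_val_eq_zero {k : Fin (n - 1)} (hk : (k : ℕ) = 0)
    {g : Equiv.Perm (Fin n)} (hl : g (leftStrand k) = leftStrand k)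
    (hr : g (rightStrand k) = rightStrand k) : Commute (permBraid g) (pureGen k) := by
  have hle : Subgroup.closure (tau '' {j : Fin (n - 1) | 2 ≤ (j : ℕ)}) ≤
      (Subgroup.centralizer {pureGen k}).comap permBraid := by
    rw [Subgroup.closure_le]
    rintro _ ⟨j, hj, rfl⟩
    rw [SetLike.mem_coe, Subgroup.mem_comap, Subgroup.mem_centralizer_singleton_iff, permBraid_tau]
    exact commute_rho_pureGen (.inl (by rwa [hk]))
  refine Subgroup.mem_centralizer_singleton_iff.1 (hle (mem_closure_tau fun x hx => ?_))
  rcases (by omega : (x : ℕ) = 0 ∨ (x : ℕ) = 1) with h | h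
  · rwa [show x = leftStrand k from Fin.ext (h.trans hk.symm)]
  · rwa [show x = rightStrand k from Fin.ext (by simp only [rightStrand]; omega)]

theorem mixed_relation_conj {G : Type*} [Group G] {s t p q : G} (h : p * q * s = t * p * q)
    (hpq : p * q * p = q * p * q) : p * q * (s * p) * (p * q)⁻¹ = t * q := by
  rw [mul_inv_eq_iff_eq_mul, ← mul_assoc (p * q), h, mul_assoc _ q p, mul_assoc t p, ← mul_assoc p,
    hpq]
  simp only [mul_assoc]

theorem permBraid_conj_pureGen_succ {i j : Fin (n - 1)} (h : (j : ℕ) = i + 1) :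
    permBraid (tau i * tau j) * pureGen i * (permBraid (tau i * tau j))⁻¹ = pureGen j := by
  rw [map_mul, permBraid_tau, permBraid_tau]
  exact mixed_relation_conj (mk_eq_mk_of_rel (.M2 i j h)) (mk_eq_mk_of_rel (.P1 i j h))

theorem exists_permBraid_conj_eq_pureGen {k : Fin (n - 1)} (hk : (k : ℕ) = 0) (i : ℕ)
    (hi : i < n - 1) :
    ∃ g : Equiv.Perm (Fin n), g (leftStrand k) = leftStrand ⟨i, hi⟩ ∧
      g (rightStrand k) = rightStrand ⟨i, hi⟩ ∧
      permBraid g * pureGen k * (permBraid g)⁻¹ = pureGen ⟨i, hi⟩ := by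
  induction i with
  | zero =>
    obtain rfl : k = ⟨0, hi⟩ := Fin.ext hk
    exact ⟨1, rfl, rfl, by simp⟩
  | succ i ih =>
    obtain ⟨g, hl, hr, hg⟩ := ih (by omega)
    let a : Fin (n - 1) := ⟨i, by omega⟩
    let b : Fin (n - 1) := ⟨i + 1, hi⟩
    refine ⟨tau a * tau b * g, ?_, ?_, ?_⟩
    · rw [Equiv.Perm.mul_apply, hl, tau_mul_tau_leftStrand rfl]
    · rw [Equiv.Perm.mul_apply, hr, tau_mul_tau_rightStrand rfl]
    · rw [← permBraid_conj_pureGen_succ (i := a) (j := b) rfl, ← hg, map_mul _ _ g]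
      group

theorem permBraid_conj_pureGen_eq {k l : Fin (n - 1)} {g h : Equiv.Perm (Fin n)}
    (hl : g (leftStrand k) = h (leftStrand l)) (hr : g (rightStrand k) = h (rightStrand l)) :
    permBraid g * pureGen k * (permBraid g)⁻¹ = permBraid h * pureGen l * (permBraid h)⁻¹ := by
  let o : Fin (n - 1) := ⟨0, k.pos⟩
  obtain ⟨p, hpl, hpr, hp⟩ := exists_permBraid_conj_eq_pureGen (k := o) rfl k k.2
  obtain ⟨q, hql, hqr, hq⟩ := exists_permBraid_conj_eq_pureGen (k := o) rfl l l.2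
  have hcomm : Commute (permBraid ((h * q)⁻¹ * (g * p))) (pureGen o) := by
    apply commute_permBraid_pureGen_of_val_eq_zero rfl <;>
      rw [Equiv.Perm.mul_apply, Equiv.Perm.inv_eq_iff_eq, Equiv.Perm.mul_apply,
        Equiv.Perm.mul_apply]
    · rw [hpl, hql, hl]
    · rw [hpr, hqr, hr]
  have hconj := hcomm.eq
  rw [← mul_inv_eq_iff_eq_mul] at hconj
  rw [← hp, ← hq]
  conv_rhs => rw [← hconj]
  simp only [map_mul, map_inv]
  group

open Classical in
/-- The pure braid `λ_{ij}`: the conjugate of some `σ_k ρ_k` by a permutation that maps the strands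
`k`, `k + 1` to `i`, `j`. By convention, `λ_{ii} = 1`. -/
noncomputable def lam (i j : Fin n) : UVB n :=
  if h : ∃ (k : Fin (n - 1)) (g : Equiv.Perm (Fin n)),
    g (leftStrand k) = i ∧ g (rightStrand k) = j
  then permBraid h.choose_spec.choose * pureGen h.choose * (permBraid h.choose_spec.choose)⁻¹
  else 1

theorem lam_apply_strands (g : Equiv.Perm (Fin n)) (k : Fin (n - 1)) :
    lam (g (leftStrand k)) (g (rightStrand k)) = permBraid g * pureGen k * (permBraid g)⁻¹ := by
  have h : ∃ (l : Fin (n - 1)) (f : Equiv.Perm (Fin n)),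
    f (leftStrand l) = g (leftStrand k) ∧ f (rightStrand l) = g (rightStrand k) := ⟨k, g, rfl, rfl⟩
  rw [lam, dif_pos h]
  obtain ⟨hl, hr⟩ := h.choose_spec.choose_spec
  exact permBraid_conj_pureGen_eq hl hr

theorem lam_strands (k : Fin (n - 1)) : lam (leftStrand k) (rightStrand k) = pureGen k := by
  simpa using lam_apply_strands 1 k

theorem lam_self (i : Fin n) : lam i i = 1 := by
  refine dif_neg ?_
  rintro ⟨k, g, hl, hr⟩
  exact leftStrand_ne_rightStrand k (g.injective (hl.trans hr.symm))

theorem exists_perm_apply_strands {i j : Fin n} (hij : i ≠ j) :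
    ∃ (k : Fin (n - 1)) (g : Equiv.Perm (Fin n)),
      g (leftStrand k) = i ∧ g (rightStrand k) = j := by
  let k : Fin (n - 1) := ⟨0, by have := Fin.val_ne_of_ne hij; omega⟩
  obtain ⟨g, hg⟩ := Equiv.Perm.exists_extending_pair ![leftStrand k, rightStrand k] ![i, j]
    (by simpa [Function.Injective, Fin.forall_fin_two, eq_comm] using leftStrand_ne_rightStrand k)
    (by simpa [Function.Injective, Fin.forall_fin_two, eq_comm] using hij)
  exact ⟨k, g, hg 0, hg 1⟩

theorem permBraid_mul_lam (f : Equiv.Perm (Fin n)) (i j : Fin n) :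
    permBraid f * lam i j = lam (f i) (f j) * permBraid f := by
  obtain rfl | hij := eq_or_ne i j
  · simp [lam_self]
  · obtain ⟨k, g, rfl, rfl⟩ := exists_perm_apply_strands hij
    have h := lam_apply_strands (f * g) k
    rw [Equiv.Perm.mul_apply, Equiv.Perm.mul_apply] at h
    rw [h, lam_apply_strands, map_mul]
    group

theorem addStrand_lam (i j : Fin n) : addStrand (lam i j) = lam i.castSucc j.castSucc := by
  obtain rfl | hij := eq_or_ne i j
  · simp [lam_self]
  · obtain ⟨k, g, rfl, rfl⟩ := exists_perm_apply_strands hij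
    rw [lam_apply_strands, map_mul, map_mul, map_inv, addStrand_permBraid, addStrand_pureGen,
      ← lam_apply_strands, ← permCastSucc_castSucc, ← permCastSucc_castSucc]
    rfl

/-! ### Commutation of the generators of the pure group -/

theorem commute_of_braid_relations {G : Type*} [Group G] {a b c p q : G}
    (hpq : p * q * p = q * p * q) (hqa : SemiconjBy q a b) (hqb : SemiconjBy q b a)
    (hpb : SemiconjBy p b c) (hpc : SemiconjBy p c b)
    (hB : a * p * (c * q) * (a * p) = c * q * (a * p) * (c * q))
    (hF : p * (c * q) * (a * p) = c * q * (a * p) * q)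
    (hF' : q * (a * p) * (c * q) = a * p * (c * q) * p) :
    Commute a b ∧ Commute b c ∧ Commute a c := by
  have hab : a * b = b * a := by
    refine mul_right_cancel (b := p * q * p) ?_
    calc a * b * (p * q * p) = a * (b * p) * (q * p) := by simp only [mul_assoc]
      _ = a * p * (c * q) * p := by rw [← hpc.eq]; simp only [mul_assoc]
      _ = q * a * p * c * q := by rw [← hF']; simp only [mul_assoc]
      _ = b * q * (p * c) * q := by rw [hqa.eq, mul_assoc _ p c]
      _ = b * (q * b) * p * q := by rw [hpc.eq]; simp only [mul_assoc]
      _ = b * a * (p * q * p) := by rw [hqb.eq, hpq]; simp only [mul_assoc]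
  have hbc : b * c = c * b := by
    refine mul_right_cancel (b := p * q * p) ?_
    calc b * c * (p * q * p) = b * (c * p) * (q * p) := by simp only [mul_assoc]
      _ = b * p * (b * q) * p := by rw [← hpb.eq]; simp only [mul_assoc]
      _ = p * c * (q * a) * p := by rw [← hqa.eq, hpc.eq]
      _ = p * (c * q) * (a * p) := by simp only [mul_assoc]
      _ = c * (q * a) * p * q := by rw [hF]; simp only [mul_assoc]
      _ = c * b * (p * q * p) := by rw [hqa.eq, hpq]; simp only [mul_assoc]
  have habc : a * b * c = c * b * a := by
    refine mul_right_cancel (b := p * q * p) ?_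
    calc a * b * c * (p * q * p) = a * b * (c * p) * (q * p) := by simp only [mul_assoc]
      _ = a * (b * p) * (b * q) * p := by rw [← hpb.eq]; simp only [mul_assoc]
      _ = a * p * (c * q) * (a * p) := by rw [← hpc.eq, ← hqa.eq]; simp only [mul_assoc]
      _ = c * (q * a) * (p * c) * q := by rw [hB]; simp only [mul_assoc]
      _ = c * b * (q * b) * p * q := by rw [hqa.eq, hpc.eq]; simp only [mul_assoc]
      _ = c * b * a * (p * q * p) := by rw [hqb.eq, hpq]; simp only [mul_assoc]
  refine ⟨hab, hbc, mul_left_cancel (a := b) ?_⟩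
  rw [← mul_assoc, ← hab, habc, ← hbc, mul_assoc]

theorem sigma_eq_lam_mul (i : Fin (n - 1)) :
    (PresentedGroup.of (Gen.sigma i) : UVB n) =
      lam (leftStrand i) (rightStrand i) * permBraid (tau i) := by
  have hrho : (PresentedGroup.of (Gen.rho i) * PresentedGroup.of (Gen.rho i) : UVB n) = 1 :=
    mk_eq_mk_of_rel (.P3 i)
  rw [lam_strands, permBraid_tau, pureGen, mul_assoc, hrho, mul_one]

theorem semiconjBy_permBraid_lam {f : Equiv.Perm (Fin n)} {i j k l : Fin n} (hi : f i = k)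
    (hj : f j = l) : SemiconjBy (permBraid f) (lam i j) (lam k l) := by
  rw [SemiconjBy, permBraid_mul_lam, hi, hj]

theorem commute_lam_strands {i j : Fin (n - 1)} (h : (j : ℕ) = i + 1) :
    Commute (lam (leftStrand i) (rightStrand i)) (lam (leftStrand i) (rightStrand j)) ∧
      Commute (lam (leftStrand i) (rightStrand j)) (lam (rightStrand i) (rightStrand j)) ∧
      Commute (lam (leftStrand i) (rightStrand i)) (lam (rightStrand i) (rightStrand j)) := by
  have hmid := rightStrand_eq_leftStrand h
  have hil : tau i (leftStrand i) = rightStrand i := tau_leftStrand i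
  have him : tau i (rightStrand i) = leftStrand i := tau_rightStrand i
  have hir : tau i (rightStrand j) = rightStrand j := by
    apply tau_apply_of_ne_of_ne <;> simp only [rightStrand] <;> omega
  have hjl : tau j (leftStrand i) = leftStrand i := by
    apply tau_apply_of_ne_of_ne <;> simp only [leftStrand] <;> omega
  have hjm : tau j (rightStrand i) = rightStrand j := by rw [hmid, tau_leftStrand]
  have hjr : tau j (rightStrand j) = rightStrand i := by rw [hmid, tau_rightStrand]
  apply commute_of_braid_relations (p := permBraid (tau i)) (q := permBraid (tau j))
    (by simp only [← map_mul, tau_braid i j h])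
    (semiconjBy_permBraid_lam hjl hjm) (semiconjBy_permBraid_lam hjl hjr)
    (semiconjBy_permBraid_lam hil hir) (semiconjBy_permBraid_lam him hir)
  all_goals rw [← sigma_eq_lam_mul, hmid, ← sigma_eq_lam_mul]
  · exact mk_eq_mk_of_rel (.B1 i j h)
  · rw [permBraid_tau, permBraid_tau]
    exact mk_eq_mk_of_rel (.F1 i j h)
  · rw [permBraid_tau, permBraid_tau]
    exact mk_eq_mk_of_rel (.F2 i j h)

theorem commute_lam_apply (f : Equiv.Perm (Fin n)) {i j k l : Fin n}
    (h : Commute (lam i j) (lam k l)) : Commute (lam (f i) (f j)) (lam (f k) (f l)) := by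
  rw [eq_mul_inv_of_mul_eq (permBraid_mul_lam f i j).symm,
    eq_mul_inv_of_mul_eq (permBraid_mul_lam f k l).symm]
  exact (Commute.conj_iff _).2 h

theorem commute_lam_triangle {i j k : Fin n} (hij : i ≠ j) (hik : i ≠ k) (hjk : j ≠ k) :
    Commute (lam i j) (lam i k) ∧ Commute (lam i k) (lam j k) ∧ Commute (lam i j) (lam j k) := by
  have hn : 2 < n := by omega
  let a : Fin (n - 1) := ⟨0, by omega⟩
  let b : Fin (n - 1) := ⟨1, by omega⟩
  obtain ⟨g, hg⟩ := Equiv.Perm.exists_extending_pair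
    ![leftStrand a, rightStrand a, rightStrand b] ![i, j, k]
    (by simp [Function.Injective, Fin.forall_fin_succ, leftStrand, rightStrand, a, b])
    (by simp [Function.Injective, Fin.forall_fin_succ, hij, hik, hjk, hij.symm, hik.symm,
      hjk.symm])
  obtain ⟨rfl, rfl, rfl⟩ : g (leftStrand a) = i ∧ g (rightStrand a) = j ∧ g (rightStrand b) = k :=
    ⟨hg 0, hg 1, hg 2⟩
  obtain ⟨h₁, h₂, h₃⟩ := commute_lam_strands (i := a) (j := b) rfl
  exact ⟨commute_lam_apply g h₁, commute_lam_apply g h₂, commute_lam_apply g h₃⟩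

theorem commute_lam_disjoint {i j k l : Fin n} (hij : i ≠ j) (hik : i ≠ k) (hil : i ≠ l)
    (hjk : j ≠ k) (hjl : j ≠ l) (hkl : k ≠ l) : Commute (lam i j) (lam k l) := by
  have hn : 3 < n := by omega
  let a : Fin (n - 1) := ⟨0, by omega⟩
  let b : Fin (n - 1) := ⟨2, by omega⟩
  obtain ⟨g, hg⟩ := Equiv.Perm.exists_extending_pair
    ![leftStrand a, rightStrand a, leftStrand b, rightStrand b] ![i, j, k, l]
    (by simp [Function.Injective, Fin.forall_fin_succ, leftStrand, rightStrand, a, b])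
    (by simp [Function.Injective, Fin.forall_fin_succ, hij, hik, hil, hjk, hjl, hkl, hij.symm,
      hik.symm, hil.symm, hjk.symm, hjl.symm, hkl.symm])
  obtain ⟨rfl, rfl, rfl, rfl⟩ : g (leftStrand a) = i ∧ g (rightStrand a) = j ∧
      g (leftStrand b) = k ∧ g (rightStrand b) = l := ⟨hg 0, hg 1, hg 2, hg 3⟩
  apply commute_lam_apply
  rw [lam_strands, lam_strands]
  exact commute_pureGen_pureGen (.inr le_rfl)

theorem commute_lam {i j k l : Fin n} (h : ¬(i = l ∧ j = k)) : Commute (lam i j) (lam k l) := by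
  obtain rfl | hij := eq_or_ne i j
  · rw [lam_self]
    exact Commute.one_left _
  obtain rfl | hkl := eq_or_ne k l
  · rw [lam_self]
    exact Commute.one_right _
  obtain rfl | hik := eq_or_ne i k
  · obtain rfl | hjl := eq_or_ne j l
    · exact Commute.refl _
    · exact (commute_lam_triangle hij hkl hjl).1
  obtain rfl | hjl := eq_or_ne j l
  · exact (commute_lam_triangle hik hij hkl).2.1
  obtain rfl | hjk := eq_or_ne j k
  · exact (commute_lam_triangle hij (fun hil => h ⟨hil, rfl⟩) hjl).2.2
  obtain rfl | hil := eq_or_ne i l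
  · exact (commute_lam_triangle hkl hjk.symm hij).2.2.symm
  · exact commute_lam_disjoint hij hik hil hjk hjl hkl

/-! ### Exchanging `λ_{ij}` and `λ_{ji}` in closures -/

theorem addStrand_permBraid_swap (i j : Fin n) :
    addStrand (permBraid (Equiv.swap i j)) =
      permBraid (Equiv.swap i.castSucc j.castSucc) := by
  rw [addStrand_permBraid]
  exact congrArg permBraid (viaEmbeddingHom_swap Fin.castSuccEmb i j)

theorem commute_rho_last_addStrand_addStrand (z : UVB n) :
    Commute (PresentedGroup.of (Gen.rho (Fin.last n))) (addStrand (addStrand z)) := by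
  let ρ : UVB (n + 2) := PresentedGroup.of (Gen.rho (Fin.last n))
  have hhom : (MulAut.conj ρ).toMonoidHom.comp (addStrand.comp addStrand) =
      addStrand.comp (addStrand : UVB n →* _) := by
    ext1 g
    simp only [MonoidHom.comp_apply, addStrand_of, MulEquiv.coe_toMonoidHom, MulAut.conj_apply,
      mul_inv_eq_iff_eq_mul]
    cases g with
    | sigma j =>
      exact (mk_eq_mk_of_rel (.M1 (n := n + 2) ⟨j, by omega⟩ (Fin.last n)
        (.inl (by simp only [Fin.val_last]; omega)))).symm
    | rho j =>
      exact (mk_eq_mk_of_rel (.P2 (n := n + 2) ⟨j, by omega⟩ (Fin.last n)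
        (.inl (by simp only [Fin.val_last]; omega)))).symm
  exact mul_inv_eq_iff_eq_mul.1 (DFunLike.congr_fun hhom z)

theorem commute_permBraid_addStrand_addStrand (z : UVB n) :
    Commute (permBraid (Equiv.swap (Fin.last n).castSucc (Fin.last (n + 1))))
      (addStrand (addStrand z)) := by
  have htau : permBraid (Equiv.swap (Fin.last n).castSucc (Fin.last (n + 1))) =
      PresentedGroup.of (Gen.rho (Fin.last n)) :=
    permBraid_tau (n := n + 2) (Fin.last n)
  exact htau ▸ commute_rho_last_addStrand_addStrand z

theorem fusedClosure_lam_mul_lam_mul {i j : Fin n} (hij : i ≠ j) (z : UVB n) :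
    fusedClosure (lam i j * lam j i * z) =
      fusedClosure (lam j.castSucc.castSucc (Fin.last n).castSucc *
        lam i.castSucc.castSucc (Fin.last (n + 1)) *
        permBraid (Equiv.swap j.castSucc.castSucc (Fin.last (n + 1)) *
          Equiv.swap i.castSucc.castSucc (Fin.last n).castSucc) * addStrand (addStrand z)) := by
  have hij₁ : i.castSucc ≠ j.castSucc := (Fin.castSucc_injective n).ne hij
  have hij₂ : i.castSucc.castSucc ≠ j.castSucc.castSucc := (Fin.castSucc_injective _).ne hij₁
  have hj : j.castSucc ≠ Fin.last n := j.castSucc_lt_last.ne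
  have hi : i.castSucc.castSucc ≠ Fin.last (n + 1) := i.castSucc.castSucc_lt_last.ne
  have hcut_i : fusedClosure (lam i j * lam j i * z) =
      fusedClosure (lam j.castSucc (Fin.last n) * (lam i.castSucc j.castSucc *
        permBraid (Equiv.swap i.castSucc (Fin.last n)) * addStrand z)) := by
    rw [mul_assoc, ← fusedClosure_cut _ _ i, map_mul, addStrand_lam, addStrand_lam]
    have hmove : permBraid (Equiv.swap i.castSucc (Fin.last n)) * lam j.castSucc i.castSucc =
        lam j.castSucc (Fin.last n) * permBraid (Equiv.swap i.castSucc (Fin.last n)) :=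
      (semiconjBy_permBraid_lam (Equiv.swap_apply_of_ne_of_ne hij₁.symm hj)
        (Equiv.swap_apply_left _ _)).eq
    have hcomm : Commute (lam i.castSucc j.castSucc) (lam j.castSucc (Fin.last n)) :=
      commute_lam fun h => i.castSucc_lt_last.ne h.1
    rw [mul_assoc, ← mul_assoc (permBraid _), hmove, ← mul_assoc, ← mul_assoc, hcomm.eq]
    simp only [mul_assoc]
  have hmove : permBraid (Equiv.swap j.castSucc.castSucc (Fin.last (n + 1))) *
      lam i.castSucc.castSucc j.castSucc.castSucc =
      lam i.castSucc.castSucc (Fin.last (n + 1)) *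
        permBraid (Equiv.swap j.castSucc.castSucc (Fin.last (n + 1))) :=
    (semiconjBy_permBraid_lam (Equiv.swap_apply_of_ne_of_ne hij₂ hi)
      (Equiv.swap_apply_left _ _)).eq
  rw [hcut_i, ← fusedClosure_cut _ _ j.castSucc]
  simp only [map_mul, addStrand_lam, addStrand_permBraid_swap]
  rw [mul_assoc, mul_assoc _ (permBraid _) (addStrand _), ← mul_assoc (permBraid _) (lam _ _),
    hmove]
  simp only [mul_assoc]

theorem fusedClosure_eq_of_semiconjBy {g x y : UVB n} (h : SemiconjBy g x y) :
    fusedClosure x = fusedClosure y := by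
  rw [← fusedClosure_conj g x, h.eq, mul_inv_cancel_right]

theorem fusedClosure_double_cut_symm {i j u v : Fin n} (hij : i ≠ j) (hiu : i ≠ u) (hiv : i ≠ v)
    (hju : j ≠ u) (hjv : j ≠ v) (huv : u ≠ v) {w : UVB n}
    (hw : Commute (permBraid (Equiv.swap u v)) w) :
    fusedClosure (lam j u * lam i v * permBraid (Equiv.swap j v * Equiv.swap i u) * w) =
      fusedClosure (lam i u * lam j v * permBraid (Equiv.swap i v * Equiv.swap j u) * w) := by
  have hi : Equiv.swap u v i = i := Equiv.swap_apply_of_ne_of_ne hiu hiv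
  have hj : Equiv.swap u v j = j := Equiv.swap_apply_of_ne_of_ne hju hjv
  have hperm : SemiconjBy (Equiv.swap u v) (Equiv.swap j v * Equiv.swap i u)
      (Equiv.swap i v * Equiv.swap j u) := by
    have hdisj : Commute (Equiv.swap i v) (Equiv.swap j u) :=
      (Equiv.Perm.disjoint_swap_swap (by grind)).commute
    rw [hdisj.eq]
    refine .mul_right ?_ ?_ <;> rw [SemiconjBy, Equiv.mul_swap_eq_swap_mul]
    · rw [hj, Equiv.swap_apply_right]
    · rw [hi, Equiv.swap_apply_left]
  have hlam : Commute (lam i u) (lam j v) := commute_lam fun h => hiv h.1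
  rw [hlam.eq]
  refine fusedClosure_eq_of_semiconjBy (g := permBraid (Equiv.swap u v))
    (.mul_right (.mul_right (.mul_right ?_ ?_) (hperm.map permBraid)) hw)
  · exact semiconjBy_permBraid_lam hj (Equiv.swap_apply_left u v)
  · exact semiconjBy_permBraid_lam hi (Equiv.swap_apply_right u v)

theorem fusedClosure_lam_exchange (i j : Fin n) (z : UVB n) :
    fusedClosure (lam i j * lam j i * z) = fusedClosure (lam j i * lam i j * z) := by
  obtain rfl | hij := eq_or_ne i j
  · rfl
  have hu (k : Fin n) : k.castSucc.castSucc ≠ (Fin.last n).castSucc :=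
    (Fin.castSucc_injective _).ne k.castSucc_lt_last.ne
  have hv (k : Fin (n + 1)) : k.castSucc ≠ Fin.last (n + 1) := k.castSucc_lt_last.ne
  rw [fusedClosure_lam_mul_lam_mul hij, fusedClosure_lam_mul_lam_mul hij.symm]
  exact fusedClosure_double_cut_symm
    (((Fin.castSucc_injective _).comp (Fin.castSucc_injective _)).ne hij) (hu i) (hv _) (hu j)
    (hv _) (hv _) (commute_permBraid_addStrand_addStrand z)

open scoped commutatorElement

/-! ### Commutators of pure braids -/

/-- The braids that may be inserted anywhere in a braid without changing its closure. -/
def closureKernel (n : ℕ) : Subgroup (UVB n) where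
  carrier := {c | ∀ z, fusedClosure (c * z) = fusedClosure z}
  one_mem' z := by rw [one_mul]
  mul_mem' hc hd z := by rw [mul_assoc, hc, hd]
  inv_mem' {c} hc z := by rw [← hc, mul_inv_cancel_left]

instance : (closureKernel n).Normal where
  conj_mem c hc g z := by
    rw [mul_assoc, mul_assoc, fusedClosure_mul_comm, mul_assoc, hc, fusedClosure_mul_comm,
      mul_inv_cancel_left]

theorem commutatorElement_mem_closureKernel {x y : UVB n}
    (h : ∀ z, fusedClosure (x * y * z) = fusedClosure (y * x * z)) : ⁅x, y⁆ ∈ closureKernel n := by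
  intro z
  rw [commutatorElement_def, mul_assoc _ y⁻¹, mul_assoc (x * y), h]
  group

theorem commutatorElement_lam_mem_closureKernel (i j k l : Fin n) :
    ⁅lam i j, lam k l⁆ ∈ closureKernel n := by
  refine commutatorElement_mem_closureKernel fun z => ?_
  by_cases h : i = l ∧ j = k
  · rw [h.1, h.2]
    exact fusedClosure_lam_exchange l k z
  · rw [(commute_lam h).eq]

theorem commutator_closure_le {G : Type*} [Group G] {s : Set G} {N : Subgroup G} [N.Normal]
    (h : ∀ x ∈ s, ∀ y ∈ s, ⁅x, y⁆ ∈ N) : ⁅Subgroup.closure s, Subgroup.closure s⁆ ≤ N := by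
  have hcomm (x y : G) : ⁅x, y⁆ ∈ N ↔ Commute (x : G ⧸ N) y := by
    rw [← commutatorElement_eq_one_iff_commute, ← QuotientGroup.eq_one_iff]
    rfl
  simp only [hcomm] at h
  refine Subgroup.commutator_le.2 fun x hx y hy => (hcomm x y).2 ?_
  induction hx, hy using Subgroup.closure_induction₂ with
  | mem x y hx hy => exact h x hx y hy
  | one_left => exact .one_left _
  | one_right => exact .one_right _
  | mul_left x y z _ _ _ hx hy => exact hx.mul_left hy
  | mul_right x y z _ _ _ hx hy => exact hx.mul_right hy
  | inv_left x y _ _ h => exact h.inv_left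
  | inv_right x y _ _ h => exact h.inv_right

/-- The subgroup generated by the pure braids `λ_{ij}`. -/
def lamSubgroup (n : ℕ) : Subgroup (UVB n) :=
  Subgroup.closure (Set.range (Function.uncurry lam))

theorem permBraid_conj_mem_lamSubgroup (g : Equiv.Perm (Fin n)) {x : UVB n}
    (hx : x ∈ lamSubgroup n) : permBraid g * x * (permBraid g)⁻¹ ∈ lamSubgroup n := by
  have hle : (lamSubgroup n).map (MulAut.conj (permBraid g)).toMonoidHom ≤ lamSubgroup n := by
    rw [lamSubgroup, MonoidHom.map_closure, Subgroup.closure_le]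
    rintro _ ⟨_, ⟨⟨i, j⟩, rfl⟩, rfl⟩
    exact Subgroup.subset_closure ⟨(g i, g j), eq_mul_inv_of_mul_eq (permBraid_mul_lam g i j).symm⟩
  exact hle ⟨x, hx, rfl⟩

theorem of_mul_permBraid_inv_mem_lamSubgroup (g : Gen n) :
    PresentedGroup.of g * (permBraid (genPerm g))⁻¹ ∈ lamSubgroup n := by
  cases g with
  | sigma i =>
    rw [sigma_eq_lam_mul, genPerm, mul_inv_cancel_right]
    exact Subgroup.subset_closure ⟨(leftStrand i, rightStrand i), rfl⟩
  | rho i =>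
    rw [genPerm, permBraid_tau, mul_inv_cancel]
    exact one_mem _

theorem mul_permBraid_inv_mem_lamSubgroup (x : UVB n) :
    x * (permBraid (iota n x))⁻¹ ∈ lamSubgroup n := by
  have hx : x ∈ Subgroup.closure (Set.range PresentedGroup.of) := by
    rw [PresentedGroup.closure_range_of]
    exact Subgroup.mem_top x
  induction hx using Subgroup.closure_induction with
  | mem x hx =>
    obtain ⟨g, rfl⟩ := hx
    rw [iota_of]
    exact of_mul_permBraid_inv_mem_lamSubgroup g
  | one => simp only [map_one, inv_one, mul_one, one_mem]
  | mul x y _ _ hx hy =>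
    convert mul_mem hx (permBraid_conj_mem_lamSubgroup (iota n x) hy) using 1
    simp only [map_mul]
    group
  | inv x _ hx =>
    convert permBraid_conj_mem_lamSubgroup (iota n x)⁻¹ (inv_mem hx) using 1
    simp only [map_inv]
    group

theorem UVP_le_lamSubgroup (n : ℕ) : UVP n ≤ lamSubgroup n := by
  intro x hx
  have h := mul_permBraid_inv_mem_lamSubgroup x
  rwa [show iota n x = 1 from hx, map_one, inv_one, mul_one] at h

theorem commutator_UVP_le_closureKernel (n : ℕ) : ⁅UVP n, UVP n⁆ ≤ closureKernel n := by
  refine (Subgroup.commutator_mono (UVP_le_lamSubgroup n) (UVP_le_lamSubgroup n)).trans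
    (commutator_closure_le ?_)
  rintro _ ⟨⟨i, j⟩, rfl⟩ _ ⟨⟨k, l⟩, rfl⟩
  exact commutatorElement_lam_mem_closureKernel i j k l

theorem fusedClosure_eq_of_mk_eq {x y : UVB n} (h : (x : UVB n ⧸ ⁅UVP n, UVP n⁆) = y) :
    fusedClosure x = fusedClosure y := by
  have hmem := commutator_UVP_le_closureKernel n (QuotientGroup.eq.1 h)
  rw [← hmem x, fusedClosure_mul_comm, mul_inv_cancel_left]

instance : (UVP n).Normal := inferInstanceAs (iota n).ker.Normal

theorem fusedClosure_eq_of_isConj_mk {x y : UVB n}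
    (h : IsConj (x : UVB n ⧸ ⁅UVP n, UVP n⁆) y) : fusedClosure x = fusedClosure y := by
  obtain ⟨c, hc⟩ := isConj_iff.1 h
  obtain ⟨g, rfl⟩ := QuotientGroup.mk_surjective c
  rw [← fusedClosure_conj g x]
  exact fusedClosure_eq_of_mk_eq hc

theorem mk_eq_mk_of_abelianization_eq {G : Type*} [Group G] {H : Subgroup G} {x y : H}
    (h : Abelianization.of x = Abelianization.of y) : ((x : G) : G ⧸ ⁅H, H⁆) = (y : G) := by
  rw [QuotientGroup.eq, ← Subgroup.map_subtype_commutator]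
  refine Subgroup.mem_map_of_mem H.subtype (x := x⁻¹ * y) ?_
  rw [← Abelianization.ker_of, MonoidHom.mem_ker, map_mul, map_inv, h, inv_mul_cancel]

end FusedLinks

open scoped commutatorElement in
theorem mainTheorem3_general {n : ℕ} {α β : FusedLinks.UVB n}
    (h : IsConj (α : FusedLinks.UVB n ⧸ ⁅FusedLinks.UVP n, FusedLinks.UVP n⁆) β)
    {D E : FusedLinks.Diagram} (hD : FusedLinks.IsClosure α D) (hE : FusedLinks.IsClosure β E) :
    D.Equivalent E := by
  rw [← FusedLinks.Diagram.link_eq_link_iff, hD.link_eq, hE.link_eq]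
  exact FusedLinks.fusedClosure_eq_of_isConj_mk h

theorem mainTheorem3 (n : ℕ) (α β : FusedLinks.UVP n)
    (a b : FusedLinks.UVP n)
    (ha : Abelianization.of a = Abelianization.of α)
    (hb : Abelianization.of b = Abelianization.of β)
    (μ : FusedLinks.UVB n) (hμ : μ ∈ FusedLinks.symmSubgroup n)
    (hconj : (b : FusedLinks.UVB n) = μ⁻¹ * (a : FusedLinks.UVB n) * μ)
    (D E : FusedLinks.Diagram)
    (hD : FusedLinks.IsClosure (α : FusedLinks.UVB n) D)
    (hE : FusedLinks.IsClosure (β : FusedLinks.UVB n) E) :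
    D.Equivalent E := by
  refine mainTheorem3_general ?_ hD hE
  rw [← FusedLinks.mk_eq_mk_of_abelianization_eq ha, ← FusedLinks.mk_eq_mk_of_abelianization_eq hb,
    hconj]
  exact isConj_iff.2 ⟨(μ⁻¹ : FusedLinks.UVB n), by rw [← QuotientGroup.mk_inv, inv_inv]; rfl⟩
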